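/- Setting. For $d>0$, the Poisson$(d)$ tree is the random rooted tree in which every vertex independently has a Poisson$(d)$ number of children. For a graph $G$ and a finite set $\Psi$ of vertices, let $\partial\Psi$ be the set of vertices outside $\Psi$ with a neighbour in $\Psi$. A boundary condition for $\Psi$ is an assignment of "occupied/unoccupied" to $\partial\Psi$ in which no two adjacent vertices are occupied. The hard-core model at fugacity $\lambda=\infty$ on $\Psi$ with boundary condition $\sigma$ is the uniform distribution $\mu_\Psi^\sigma$ over the maximum-size sets $S\subseteq\Psi$ such that $S$ together with the vertices occupied under $\sigma$ is an independent set. For a finite set $\Lambda$ of vertices, weak spatial mixing (WSM) holds at $\Lambda$ if $\|\mu_{\Psi_n}^{\sigma_n}-\mu_{\Psi_n}^{\tau_n}\|_\Lambda\to 0$ (total variation distance of the marginals on $\Lambda$) for every sequence of finite sets $\Psi_n\supseteq\Lambda$ and boundary conditions $\sigma_n,\tau_n$ for $\Psi_n$ with $\mathrm{dist}(\Lambda,\partial\Psi_n)\to\infty$; strong spatial mixing (SSM) holds at $\Lambda$ if the same is true under the weaker requirement $\mathrm{dist}(\Lambda,\sigma_n\oplus\tau_n)\to\infty$, where $\sigma_n\oplus\tau_n$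 is the set of vertices on which $\sigma_n$ and $\tau_n$ differ (the distance to the empty set is $\infty$). $G$ has WSM (SSM) if WSM (SSM) holds at every finite $\Lambda$. Theorem. There is a largest constant $d^*>1$ with the following property: for all $1<d<d^*$, the Poisson$(d)$ tree, conditioned to be infinite, almost surely has WSM but not SSM at $\lambda=\infty$. Moreover $$\frac{e^{1/\sqrt2}}{\sqrt2}\le d^*\le e .$$ Furthermore, for every $d>e$, with positive probability WSM at $\lambda=\infty$ fails at the root (that is, at $\Lambda=\{\text{root}\}$) of the Poisson$(d)$ tree. -/

import Mathlib

noncomputable section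

namespace HardCore

section Model

variable {V : Type*} (G : SimpleGraph V)

/-- The boundary of a finite patch `Ψ`: the vertices outside `Ψ` that have a neighbour in `Ψ`.
These are the vertices whose spins are frozen by a boundary condition on `Ψ`. -/
def boundary (Ψ : Finset V) : Set V :=
  {v | v ∉ Ψ ∧ ∃ w ∈ Ψ, G.Adj w v}

/-- A (feasible) boundary condition for the patch `Ψ`. A `{occupied, unoccupied}`-valued
configuration on the boundary is encoded by its set `σ` of occupied vertices; adjacent vertices
may not both be occupied. -/
def IsBoundaryCondition (Ψ : Finset V) (σ : Set V) : Prop :=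
  σ ⊆ boundary G Ψ ∧ G.IsIndepSet σ

open Classical in
/-- The configurations on `Ψ` (sets of occupied vertices) that together with the boundary
condition `σ` form an independent set. -/
def admissible (Ψ : Finset V) (σ : Set V) : Finset (Finset V) :=
  Ψ.powerset.filter fun S => G.IsIndepSet (↑S ∪ σ)

open Classical in
/-- The admissible configurations on `Ψ` of maximum possible size. -/
def maxConfigs (Ψ : Finset V) (σ : Set V) : Finset (Finset V) :=
  (admissible G Ψ σ).filter fun S => ∀ S' ∈ admissible G Ψ σ, S'.card ≤ S.card

open Classical in
/-- The marginal on `Λ` of the hard-core measure on `Ψ` at fugacity `λ = ∞` with boundary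
condition `σ`: the probability that the set of occupied vertices of `Λ` is exactly `A`, for a
uniformly random element of `maxConfigs G Ψ σ`. -/
def marginal (Ψ : Finset V) (σ : Set V) (Λ A : Finset V) : ℝ :=
  (((maxConfigs G Ψ σ).filter fun S => S ∩ Λ = A).card : ℝ) / ((maxConfigs G Ψ σ).card : ℝ)

/-- The total variation distance between the marginals on `Λ` of the hard-core measures
(at `λ = ∞`) on `Ψ` with boundary conditions `σ` and `τ`. -/
def tvDist (Ψ : Finset V) (σ τ : Set V) (Λ : Finset V) : ℝ :=
  (1 / 2) * ∑ A ∈ Λ.powerset, |marginal G Ψ σ Λ A - marginal G Ψ τ Λ A|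

/-- Graph distance from a finite set of vertices to a set of vertices (`⊤` if one is empty). -/
def setDist (Λ : Finset V) (B : Set V) : ℕ∞ :=
  ⨅ u ∈ Λ, ⨅ v ∈ B, G.edist u v

/-- Weak spatial mixing at the finite set `Λ`, for the hard-core model at `λ = ∞`: the marginals
on `Λ` merge along every sequence of patches and pairs of boundary conditions for which the
boundary recedes to infinity. -/
def WSMAt (Λ : Finset V) : Prop :=
  ∀ (Ψ : ℕ → Finset V) (σ τ : ℕ → Set V),
    (∀ n, Λ ⊆ Ψ n) →
    (∀ n, IsBoundaryCondition G (Ψ n) (σ n)) →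
    (∀ n, IsBoundaryCondition G (Ψ n) (τ n)) →
    Filter.Tendsto (fun n => setDist G Λ (boundary G (Ψ n))) Filter.atTop (nhds ⊤) →
    Filter.Tendsto (fun n => tvDist G (Ψ n) (σ n) (τ n) Λ) Filter.atTop (nhds 0)

/-- Strong spatial mixing at the finite set `Λ`, for the hard-core model at `λ = ∞`: as for weak
spatial mixing, but only the disagreement set of the two boundary conditions has to recede. -/
def SSMAt (Λ : Finset V) : Prop :=
  ∀ (Ψ : ℕ → Finset V) (σ τ : ℕ → Set V),
    (∀ n, Λ ⊆ Ψ n) →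
    (∀ n, IsBoundaryCondition G (Ψ n) (σ n)) →
    (∀ n, IsBoundaryCondition G (Ψ n) (τ n)) →
    Filter.Tendsto (fun n => setDist G Λ (symmDiff (σ n) (τ n))) Filter.atTop (nhds ⊤) →
    Filter.Tendsto (fun n => tvDist G (Ψ n) (σ n) (τ n) Λ) Filter.atTop (nhds 0)

/-- Weak spatial mixing of the hard-core model on `G` at fugacity `λ = ∞`. -/
def WSM : Prop := ∀ Λ : Finset V, WSMAt G Λ

/-- Strong spatial mixing of the hard-core model on `G` at fugacity `λ = ∞`. -/
def SSM : Prop := ∀ Λ : Finset V, SSMAt G Λ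

end Model

section Tree

/-- Vertices of the rooted tree with prescribed numbers of children. A potential vertex is a list
of natural numbers: the root is `[]`, and the `i`-th child of `l` is `i :: l`. If `c l` is the
number of children of `l`, then `i :: l` is a vertex iff `l` is one and `i < c l`. -/
def InTree (c : List ℕ → ℕ) : List ℕ → Prop
  | [] => True
  | i :: l => i < c l ∧ InTree c l

/-- The vertex type of the tree with child counts `c`. -/
abbrev Vertex (c : List ℕ → ℕ) : Type := {l : List ℕ // InTree c l}

/-- The root of the tree with child counts `c`. -/
def root (c : List ℕ → ℕ) : Vertex c := ⟨[], trivial⟩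

/-- The tree with child counts `c`, as a graph: a vertex is adjacent to its children. -/
def tree (c : List ℕ → ℕ) : SimpleGraph (Vertex c) where
  Adj u v := (∃ i : ℕ, v.1 = i :: u.1) ∨ (∃ i : ℕ, u.1 = i :: v.1)
  symm := ⟨fun _ _ h => h.symm⟩
  loopless := ⟨fun u h => by
    rcases h with ⟨i, h⟩ | ⟨i, h⟩ <;> simpa using congrArg List.length h⟩

/-- The law of the Poisson tree of average arity `d`, as a law on child counts: the numbers of
children are independent Poisson random variables with mean `d`. -/
def poissonTree (d : ℝ) : MeasureTheory.Measure (List ℕ → ℕ) :=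
  MeasureTheory.Measure.infinitePi fun _ : List ℕ => ProbabilityTheory.poissonMeasure d.toNNReal

/-- The law of the Poisson tree of average arity `d`, conditioned on the tree being infinite. -/
def poissonTreeInf (d : ℝ) : MeasureTheory.Measure (List ℕ → ℕ) :=
  ProbabilityTheory.cond (poissonTree d) {c | Infinite (Vertex c)}

end Tree

end HardCore

end

/-! At `λ = ∞` the model on a tree is controlled by the game in which a token moves from parent to
child and a player who cannot move loses. Exchanging along alternating trees (`exists_exchange`)
shows that, in a patch deep enough to see the game end, a lost vertex with unoccupied parent lies in
every maximum configuration (`mem_of_isLosing`), while a vertex with two lost children lies in none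
(`notMem_of_isLosing`), since trading it for those two gains a vertex. Vertices of the latter kind
screen off everything beyond them (`marginal_eq_of_boundary_unoccupied`), so weak mixing follows
once the clusters of the other vertices are finite (`wsm_of_reach`).

The probability x of a lost root is a fixed point of F(t) = exp(-d exp(-d t)). For d < e the only
fixed point of F is that of exp(-d t); hence there are almost surely no draws, and y = d x satisfies
y e^y = d. The cluster behaves like a branching process with two types, lost and won, whose survival
probabilities are bounded through the matrix [[0, y], [y, y²]]. Its spectral radius is below 1
exactly when 2 y² < 1, that is, when d < e^{1/√2}/√2 (`prob_iInter_reach`).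

For d > e the fixed point of exp(-d t) repels under F, the iterates of F from 0 stop short of it,
and draws occur (`prob_draw_pos`). When the root has exactly two children, both drawn, its spin is
dictated by the boundary condition on a distant sphere (`not_wsmAt_root`).

Strong mixing fails because an infinite tree almost surely contains a two-sided infinite path
(`ae_exists_branching`), and on a long path the parity of the length is felt at the centre
(`not_ssmAt_of_twoChildren`). -/

namespace HardCore

open MeasureTheory ProbabilityTheory

/-! ### Poisson sums and the branching property -/

/-- The child counts of the subtree rooted at `l`. -/
def shift (l : List ℕ) (c : List ℕ → ℕ) : List ℕ → ℕ := fun m => c (m ++ l)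

lemma shift_nil (c : List ℕ → ℕ) : shift [] c = c := by
  funext m; simp [shift]

lemma shift_shift (l m : List ℕ) (c : List ℕ → ℕ) :
    shift m (shift l c) = shift (m ++ l) c := by
  funext k; simp [shift]

lemma shift_apply_nil (l : List ℕ) (c : List ℕ → ℕ) : shift l c [] = c l := rfl

lemma measurable_shift (l : List ℕ) : Measurable (shift l) := by
  unfold shift; fun_prop

/-- The weights of the Poisson distribution of mean `d`. -/
noncomputable def poissonWeight (d : ℝ) (m : ℕ) : ℝ := Real.exp (-d) * d ^ m / m.factorial

lemma poissonWeight_pos {d : ℝ} (hd : 0 < d) (m : ℕ) : 0 < poissonWeight d m := by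
  unfold poissonWeight; positivity

lemma poissonWeight_succ_mul (d : ℝ) (m : ℕ) :
    poissonWeight d (m + 1) * (m + 1 : ℕ) = d * poissonWeight d m := by
  unfold poissonWeight
  rw [Nat.factorial_succ]
  push_cast
  have : (m.factorial : ℝ) ≠ 0 := by positivity
  have : (m + 1 : ℝ) ≠ 0 := by positivity
  field_simp
  ring

lemma hasSum_poissonWeight_pow (d b : ℝ) :
    HasSum (fun m => poissonWeight d m * b ^ m) (Real.exp (-(d * (1 - b)))) := by
  have h := (NormedSpace.expSeries_div_hasSum_exp (d * b)).mul_left (Real.exp (-d))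
  rw [← Real.exp_eq_exp_ℝ, ← Real.exp_add] at h
  convert! h using 1
  · funext m; unfold poissonWeight; rw [mul_pow]; ring
  · ring_nf

/-- Size-biasing a Poisson variable shifts it by one. The factor `m` kills the term `m = 0`, so the
truncated exponent `m - 1` is harmless. -/
lemma hasSum_poissonWeight_one (d a b : ℝ) :
    HasSum (fun m : ℕ => poissonWeight d m * (m * (a * b ^ (m - 1))))
      (d * a * Real.exp (-(d * (1 - b)))) := by
  rw [← hasSum_nat_add_iff' 1]
  convert! (hasSum_poissonWeight_pow d b).mul_left (d * a) using 1
  · funext m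
    rw [← mul_assoc, poissonWeight_succ_mul]
    simp; ring
  · simp

lemma hasSum_poissonWeight_two (d a b : ℝ) :
    HasSum (fun m : ℕ => poissonWeight d m * (m * ((m - 1 : ℕ) * (a * b ^ (m - 2)))))
      (d ^ 2 * a * Real.exp (-(d * (1 - b)))) := by
  rw [← hasSum_nat_add_iff' 1]
  convert! (hasSum_poissonWeight_one d a b).mul_left d using 1
  · funext m
    rw [← mul_assoc, poissonWeight_succ_mul]
    rw [mul_assoc]; rfl
  · simp; ring

variable {d : ℝ}

instance : IsProbabilityMeasure (poissonTree d) := by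
  unfold poissonTree; infer_instance

/-- Every vertex of a tree is the root or lies in the subtree of a unique child of the root. -/
def blockIndex : (Σ o : Option ℕ, Option.rec Unit (fun _ => List ℕ) o) → List ℕ
  | ⟨none, _⟩ => []
  | ⟨some i, l⟩ => l ++ [i]

lemma blockIndex_injective : Function.Injective blockIndex := by
  rintro ⟨_ | i, x⟩ ⟨_ | j, y⟩ h
  · rfl
  · simp [blockIndex] at h
  · simp [blockIndex] at h
  · simp only [blockIndex] at h
    obtain ⟨h1, h2⟩ := List.append_inj' h rfl
    obtain rfl : i = j := by simpa using h2
    obtain rfl : x = y := h1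
    rfl

lemma infinitePi_poissonMeasure_eval {ι : Type*} (hd : 0 < d) (i : ι) (m : ℕ) :
    (Measure.infinitePi fun _ : ι => poissonMeasure d.toNNReal).real {c | c i = m} =
      poissonWeight d m := by
  have h := Measure.infinitePi_map_eval (fun _ : ι => poissonMeasure d.toNNReal) i
  have h2 := map_measureReal_apply (μ := Measure.infinitePi fun _ : ι => poissonMeasure d.toNNReal)
    (measurable_pi_apply i) (MeasurableSet.singleton m)
  rw [h, poissonMeasure_real_singleton, Real.coe_toNNReal _ hd.le] at h2
  exact h2.symm

/-- An i.i.d. family stays i.i.d. when reindexed along an injection and cut into blocks: block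
`none` is the count at the root, block `some i` is the subtree below `[i]`, whether or not that
child is present. -/
lemma map_blocks_poissonTree :
    (poissonTree d).map (fun c o k => c (blockIndex ⟨o, k⟩)) =
      Measure.infinitePi fun o : Option ℕ =>
        Measure.infinitePi fun _ : Option.rec Unit (fun _ => List ℕ) o =>
          poissonMeasure d.toNNReal := by
  have h1 := Measure.map_infinitePi_infinitePi_of_inj
    (P := fun _ : List ℕ => poissonMeasure d.toNNReal) blockIndex_injective
  have h2 := Measure.infinitePi_map_piCurry
    (fun (o : Option ℕ) (_ : Option.rec Unit (fun _ => List ℕ) o) => poissonMeasure d.toNNReal)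
  rw [← h2, ← h1, Measure.map_map (by fun_prop) (by fun_prop)]
  rfl

/-- The branching property: the number of children of the root and the subtrees of the children
are independent, and the subtrees have the law of the tree. -/
lemma poissonTree_branching (hd : 0 < d) (m : ℕ) {E : ℕ → Set (List ℕ → ℕ)}
    (hE : ∀ i, MeasurableSet (E i)) :
    (poissonTree d).real {c | c [] = m ∧ ∀ i < m, shift [i] c ∈ E i} =
      poissonWeight d m * ∏ i ∈ Finset.range m, (poissonTree d).real (E i) := by
  classical
  let t : (o : Option ℕ) → Set (Option.rec Unit (fun _ => List ℕ) o → ℕ) := fun o =>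
    match o with
    | none => {f | f () = m}
    | some i => E i
  have ht : ∀ o, MeasurableSet (t o) := by
    rintro (_ | i)
    · exact measurableSet_eq_fun (measurable_pi_apply _) measurable_const
    · exact hE i
  let s : Finset (Option ℕ) := insert none ((Finset.range m).map Function.Embedding.some)
  have h := congrArg (fun ν => ν.real ((s : Set (Option ℕ)).pi t)) (map_blocks_poissonTree (d := d))
  beta_reduce at h
  rw [map_measureReal_apply (by fun_prop)
    (MeasurableSet.pi (Finset.countable_toSet _) fun o _ => ht o)] at h
  rw [measureReal_def (Measure.infinitePi _), Measure.infinitePi_pi _ (fun o _ => ht o),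
    ENNReal.toReal_prod, Finset.prod_insert (by simp), Finset.prod_map] at h
  have hroot := infinitePi_poissonMeasure_eval hd () m
  rw [← hroot]
  convert h using 2
  rotate_left
  · rfl
  · rfl
  ext c
  simp only [s, Set.mem_ofPred_eq, Set.mem_preimage, Set.mem_pi, Finset.coe_insert,
    Finset.coe_map, Set.mem_insert_iff, forall_eq_or_imp]
  refine and_congr Iff.rfl ?_
  constructor
  · rintro h _ ⟨i, hi, rfl⟩
    exact h i (by simpa using hi)
  · intro h i hi
    exact h (some i) ⟨i, by simpa using hi, rfl⟩

lemma measurePreserving_shift (l : List ℕ) :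
    MeasurePreserving (shift l) (poissonTree d) (poissonTree d) := by
  refine ⟨measurable_shift l, ?_⟩
  exact Measure.map_infinitePi_infinitePi_of_inj
    (P := fun _ : List ℕ => poissonMeasure d.toNNReal) (f := fun m => m ++ l)
    (List.append_left_injective l)

lemma hasSum_root (E : Set (List ℕ → ℕ)) (hE : MeasurableSet E) :
    HasSum (fun m => (poissonTree d).real (E ∩ {c | c [] = m})) ((poissonTree d).real E) := by
  have h : E = ⋃ m, E ∩ {c | c [] = m} := by ext c; simp
  have hm : ∀ m : ℕ, MeasurableSet {c : List ℕ → ℕ | c [] = m} := fun m =>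
    measurableSet_eq_fun (measurable_pi_apply _) measurable_const
  have h2 : poissonTree d E = ∑' m, poissonTree d (E ∩ {c | c [] = m}) := by
    conv_lhs => rw [h]
    refine measure_iUnion ?_ fun m => hE.inter (hm m)
    intro m n hmn
    refine Set.disjoint_left.2 ?_
    rintro c ⟨_, h1⟩ ⟨_, h2⟩
    exact hmn (h1.symm.trans h2)
  have hne : ∑' m, poissonTree d (E ∩ {c | c [] = m}) ≠ ⊤ := h2 ▸ measure_ne_top _ _
  simp only [measureReal_def, h2]
  rw [ENNReal.tsum_toReal_eq (ENNReal.ne_top_of_tsum_ne_top hne)]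
  exact ENNReal.hasSum_toReal hne

/-- Given `m` children the probability is the `m`-th power of that of `E`; the sum is the Poisson
generating function. -/
lemma poissonTree_forall_children (hd : 0 < d) {E : Set (List ℕ → ℕ)} (hE : MeasurableSet E)
    {F : Set (List ℕ → ℕ)} (hF : MeasurableSet F)
    (h : ∀ c, c ∈ F ↔ ∀ i < c [], shift [i] c ∈ E) :
    (poissonTree d).real F = Real.exp (-(d * (1 - (poissonTree d).real E))) := by
  refine (hasSum_root F hF).unique ?_
  convert! hasSum_poissonWeight_pow d ((poissonTree d).real E) using 1
  funext m
  have := poissonTree_branching hd m (E := fun _ => E) fun _ => hE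
  rw [Finset.prod_const, Finset.card_range] at this
  rw [← this]
  congr 1
  ext c
  simp only [Set.mem_inter_iff, h, Set.mem_ofPred_eq]
  constructor
  · rintro ⟨h1, h2⟩; subst h2; exact ⟨rfl, h1⟩
  · rintro ⟨h1, h2⟩; subst h1; exact ⟨h2, rfl⟩

/-- Union bound over the distinguished child. Each of the `m` choices has probability `P(A)
P(B)^(m-1)`, and size-biasing evaluates the sum. -/
lemma poissonTree_exists_child_le (hd : 0 < d) {A B F : Set (List ℕ → ℕ)} (hA : MeasurableSet A)
    (hB : MeasurableSet B) (hF : MeasurableSet F)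
    (h : ∀ c ∈ F, ∃ i < c [], shift [i] c ∈ A ∧ ∀ j < c [], j ≠ i → shift [j] c ∈ B) :
    (poissonTree d).real F ≤ d * (poissonTree d).real A *
      Real.exp (-(d * (1 - (poissonTree d).real B))) := by
  classical
  refine hasSum_le ?_ (hasSum_root F hF) (hasSum_poissonWeight_one d _ _)
  intro m
  have hsub : F ∩ {c | c [] = m} ⊆ ⋃ i ∈ Finset.range m,
      {c | c [] = m ∧ ∀ j < m, shift [j] c ∈ if j = i then A else B} := by
    rintro c ⟨hc, hm⟩
    obtain ⟨i, hi, hiA, hB⟩ := h c hc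
    simp only [Set.mem_ofPred_eq] at hm
    subst hm
    simp only [Set.mem_iUnion, Finset.mem_range]
    refine ⟨i, hi, rfl, fun j hj => ?_⟩
    split_ifs with hji
    · subst hji; exact hiA
    · exact hB j hj hji
  refine (measureReal_mono hsub (measure_ne_top _ _)).trans ((measureReal_biUnion_finset_le _ _).trans ?_)
  have : ∀ i ∈ Finset.range m, (poissonTree d).real
      {c | c [] = m ∧ ∀ j < m, shift [j] c ∈ if j = i then A else B} =
      poissonWeight d m * ((poissonTree d).real A * (poissonTree d).real B ^ (m - 1)) := by
    intro i hi
    rw [poissonTree_branching hd m (E := fun j => if j = i then A else B)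
      (fun j => by split_ifs <;> assumption)]
    congr 1
    rw [← Finset.mul_prod_erase _ _ hi, if_pos rfl]
    congr 1
    rw [Finset.prod_congr rfl (g := fun _ => (poissonTree d).real B)]
    · rw [Finset.prod_const, Finset.card_erase_of_mem hi, Finset.card_range]
    · intro j hj; rw [if_neg (Finset.ne_of_mem_erase hj)]
  rw [Finset.sum_congr rfl this, Finset.sum_const, Finset.card_range, nsmul_eq_mul]
  exact le_of_eq (by ring)

/-- The same union bound over ordered pairs of distinct children, with the second factorial moment.
-/
lemma poissonTree_exists_two_children_le (hd : 0 < d) {A A' B F : Set (List ℕ → ℕ)}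
    (hA : MeasurableSet A) (hA' : MeasurableSet A') (hB : MeasurableSet B) (hF : MeasurableSet F)
    (h : ∀ c ∈ F, ∃ i < c [], ∃ j < c [], j ≠ i ∧ shift [i] c ∈ A ∧ shift [j] c ∈ A' ∧
      ∀ k < c [], k ≠ i → k ≠ j → shift [k] c ∈ B) :
    (poissonTree d).real F ≤ d ^ 2 * ((poissonTree d).real A * (poissonTree d).real A') *
      Real.exp (-(d * (1 - (poissonTree d).real B))) := by
  classical
  refine hasSum_le ?_ (hasSum_root F hF) (hasSum_poissonWeight_two d _ _)
  intro m
  have hsub : F ∩ {c | c [] = m} ⊆ ⋃ i ∈ Finset.range m, ⋃ j ∈ (Finset.range m).erase i,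
      {c | c [] = m ∧ ∀ k < m, shift [k] c ∈ if k = i then A else if k = j then A' else B} := by
    rintro c ⟨hc, hm⟩
    obtain ⟨i, hi, j, hj, hji, hiA, hjA, hB⟩ := h c hc
    simp only [Set.mem_ofPred_eq] at hm
    subst hm
    simp only [Set.mem_iUnion, Finset.mem_range, Finset.mem_erase]
    refine ⟨i, hi, j, ⟨hji, hj⟩, rfl, fun k hk => ?_⟩
    split_ifs with hki hkj
    · subst hki; exact hiA
    · subst hkj; exact hjA
    · exact hB k hk hki hkj
  refine (measureReal_mono hsub (measure_ne_top _ _)).trans ((measureReal_biUnion_finset_le _ _).trans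
    ((Finset.sum_le_sum fun i _ => measureReal_biUnion_finset_le _ _).trans ?_))
  have : ∀ i ∈ Finset.range m, ∀ j ∈ (Finset.range m).erase i, (poissonTree d).real
      {c | c [] = m ∧ ∀ k < m, shift [k] c ∈ if k = i then A else if k = j then A' else B} =
      poissonWeight d m * ((poissonTree d).real A * (poissonTree d).real A' *
        (poissonTree d).real B ^ (m - 2)) := by
    intro i hi j hj
    rw [poissonTree_branching hd m (E := fun k => if k = i then A else if k = j then A' else B)
      (fun k => by split_ifs <;> assumption)]
    congr 1
    rw [← Finset.mul_prod_erase _ _ hi, if_pos rfl, ← Finset.mul_prod_erase _ _ hj,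
      if_neg (Finset.ne_of_mem_erase hj), if_pos rfl, ← mul_assoc]
    congr 1
    rw [Finset.prod_congr rfl (g := fun _ => (poissonTree d).real B)]
    · rw [Finset.prod_const, Finset.card_erase_of_mem hj, Finset.card_erase_of_mem hi,
        Finset.card_range, Nat.sub_sub]
    · intro k hk
      rw [if_neg (Finset.ne_of_mem_erase (Finset.mem_of_mem_erase hk)),
        if_neg (Finset.ne_of_mem_erase hk)]
  rw [Finset.sum_congr rfl fun i hi => (Finset.sum_congr rfl (this i hi)).trans
    (by rw [Finset.sum_const, Finset.card_erase_of_mem hi, Finset.card_range]),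
    Finset.sum_const, Finset.card_range]
  simp only [nsmul_eq_mul]
  exact le_of_eq (by ring)

end HardCore

/-! ### Events about the children of the root -/

namespace HardCore

open MeasureTheory ProbabilityTheory

/-- All children of the root have a subtree in `E`. -/
def allChildren (E : Set (List ℕ → ℕ)) : Set (List ℕ → ℕ) := {c | ∀ i < c [], shift [i] c ∈ E}

/-- Some child of the root has a subtree in `E`. -/
def someChild (E : Set (List ℕ → ℕ)) : Set (List ℕ → ℕ) := {c | ∃ i < c [], shift [i] c ∈ E}

/-- Two children of the root have a subtree in `E`. -/
def twoChildren (E : Set (List ℕ → ℕ)) : Set (List ℕ → ℕ) :=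
  {c | ∃ i < c [], ∃ j < c [], i ≠ j ∧ shift [i] c ∈ E ∧ shift [j] c ∈ E}

lemma measurableSet_child {E : Set (List ℕ → ℕ)} (hE : MeasurableSet E) (i : ℕ) :
    MeasurableSet {c : List ℕ → ℕ | i < c [] ∧ shift [i] c ∈ E} :=
  (measurableSet_lt measurable_const (measurable_pi_apply _)).inter (measurable_shift _ hE)

lemma measurableSet_someChild {E : Set (List ℕ → ℕ)} (hE : MeasurableSet E) :
    MeasurableSet (someChild E) := by
  have : someChild E = ⋃ i, {c : List ℕ → ℕ | i < c [] ∧ shift [i] c ∈ E} := by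
    ext c; simp [someChild]
  rw [this]
  exact .iUnion fun i => measurableSet_child hE i

lemma compl_someChild (E : Set (List ℕ → ℕ)) : (someChild E)ᶜ = allChildren Eᶜ := by
  ext c; simp [allChildren, someChild]

lemma measurableSet_allChildren {E : Set (List ℕ → ℕ)} (hE : MeasurableSet E) :
    MeasurableSet (allChildren E) := by
  rw [← compl_compl E, ← compl_someChild]
  exact (measurableSet_someChild hE.compl).compl

lemma measurableSet_twoChildren {E : Set (List ℕ → ℕ)} (hE : MeasurableSet E) :
    MeasurableSet (twoChildren E) := by
  have : twoChildren E = ⋃ i, ⋃ j, ⋃ _ : i ≠ j,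
      ({c : List ℕ → ℕ | i < c [] ∧ shift [i] c ∈ E} ∩
        {c : List ℕ → ℕ | j < c [] ∧ shift [j] c ∈ E}) := by
    ext c
    simp only [twoChildren, Set.mem_iUnion, Set.mem_inter_iff, Set.mem_ofPred_eq]
    constructor
    · rintro ⟨i, hi, j, hj, hij, h1, h2⟩; exact ⟨i, j, hij, ⟨hi, h1⟩, hj, h2⟩
    · rintro ⟨i, j, hij, ⟨hi, h1⟩, hj, h2⟩; exact ⟨i, hi, j, hj, hij, h1, h2⟩
  rw [this]
  exact .iUnion fun i => .iUnion fun j => .iUnion fun _ =>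
    (measurableSet_child hE i).inter (measurableSet_child hE j)

lemma someChild_mono {E F : Set (List ℕ → ℕ)} (h : E ⊆ F) : someChild E ⊆ someChild F :=
  fun _ ⟨i, hi, hE⟩ => ⟨i, hi, h hE⟩

lemma allChildren_mono {E F : Set (List ℕ → ℕ)} (h : E ⊆ F) : allChildren E ⊆ allChildren F :=
  fun _ hc i hi => h (hc i hi)

/-- Trees have finitely many children, so a monotone union commutes with `allChildren`. -/
lemma allChildren_iUnion {E : ℕ → Set (List ℕ → ℕ)} (hE : Monotone E) :
    allChildren (⋃ n, E n) = ⋃ n, allChildren (E n) := by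
  refine Set.Subset.antisymm ?_ (Set.iUnion_subset fun n => allChildren_mono (Set.subset_iUnion _ n))
  intro c hc
  simp only [allChildren, Set.mem_iUnion, Set.mem_ofPred_eq] at hc
  choose! f hf using hc
  refine Set.mem_iUnion.2 ⟨(Finset.range (c [])).sup f, fun i hi => ?_⟩
  exact hE (Finset.le_sup (f := f) (Finset.mem_range.2 hi)) (hf i hi)

lemma someChild_iUnion (E : ℕ → Set (List ℕ → ℕ)) :
    someChild (⋃ n, E n) = ⋃ n, someChild (E n) := by
  ext c
  simp only [someChild, Set.mem_iUnion, Set.mem_ofPred_eq]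
  constructor
  · rintro ⟨i, hi, n, h⟩; exact ⟨n, i, hi, h⟩
  · rintro ⟨n, i, hi, h⟩; exact ⟨i, hi, n, h⟩

/-! ### The game: lost, won and drawn positions, and the screened cluster -/

section Game

/-- The trees whose root is a lost position, within `n` rounds, of the game in which two players
alternately move a token from a vertex to a child, and a player who cannot move loses. -/
def losesIn : ℕ → Set (List ℕ → ℕ)
  | 0 => ∅
  | n + 1 => allChildren (someChild (losesIn n))

/-- The trees whose root is a lost position. -/
def lose : Set (List ℕ → ℕ) := ⋃ n, losesIn n

/-- The trees whose root is a won position. -/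
def win : Set (List ℕ → ℕ) := someChild lose

lemma losesIn_mono : Monotone losesIn := by
  refine monotone_nat_of_le_succ fun n => ?_
  induction n with
  | zero => exact Set.empty_subset _
  | succ n ih => exact allChildren_mono (someChild_mono ih)

/-- Every vertex has finitely many children, so finitely many bounds on the number of rounds have a
maximum. -/
lemma lose_eq : lose = allChildren win := by
  have h : Monotone fun n => someChild (losesIn n) := fun m n hmn => someChild_mono (losesIn_mono hmn)
  rw [win, lose, someChild_iUnion, allChildren_iUnion h]
  refine Set.Subset.antisymm (Set.iUnion_subset fun n => ?_) (Set.iUnion_subset fun n => ?_)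
  · cases n with
    | zero => exact Set.empty_subset _
    | succ n => exact Set.subset_iUnion (fun n => allChildren (someChild (losesIn n))) n
  · exact Set.subset_iUnion losesIn (n + 1)

lemma disjoint_lose_win : Disjoint lose win := by
  have : ∀ n c, c ∈ losesIn n → c ∉ win := by
    intro n
    induction n with
    | zero => intro c hc; exact hc.elim
    | succ n ih =>
      rintro c hc ⟨i, hi, h⟩
      obtain ⟨j, hj, h2⟩ := hc i hi
      rw [lose_eq] at h
      exact ih _ h2 (h j hj)
  refine Set.disjoint_left.2 fun c hc => ?_
  obtain ⟨n, hn⟩ := Set.mem_iUnion.1 hc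
  exact this n c hn

lemma measurableSet_losesIn (n : ℕ) : MeasurableSet (losesIn n) := by
  induction n with
  | zero => exact .empty
  | succ n ih => exact measurableSet_allChildren (measurableSet_someChild ih)

lemma measurableSet_lose : MeasurableSet lose := .iUnion measurableSet_losesIn

lemma measurableSet_win : MeasurableSet win := measurableSet_someChild measurableSet_lose

/-- The positions that are neither lost nor won. -/
def draw : Set (List ℕ → ℕ) := (lose ∪ win)ᶜ

lemma measurableSet_draw : MeasurableSet draw :=
  (measurableSet_lose.union measurableSet_win).compl

/-- The trees with a vertex at distance `n` from the root that can be reached from the root without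
using (including the end points) a vertex that has two lost children. -/
def reach : ℕ → Set (List ℕ → ℕ)
  | 0 => (twoChildren lose)ᶜ
  | n + 1 => (twoChildren lose)ᶜ ∩ someChild (reach n)

lemma reach_subset (n : ℕ) : reach n ⊆ (twoChildren lose)ᶜ := by
  cases n with
  | zero => exact subset_rfl
  | succ n => exact Set.inter_subset_left

lemma reach_anti : Antitone reach := by
  refine antitone_nat_of_succ_le fun n => ?_
  induction n with
  | zero => exact Set.inter_subset_left
  | succ n ih => exact Set.inter_subset_inter_right _ (someChild_mono ih)

lemma measurableSet_reach (n : ℕ) : MeasurableSet (reach n) := by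
  induction n with
  | zero => exact (measurableSet_twoChildren measurableSet_lose).compl
  | succ n ih =>
    exact (measurableSet_twoChildren measurableSet_lose).compl.inter (measurableSet_someChild ih)

end Game

/-! ### Probabilities of game outcomes and of long clusters -/

section Probability

variable {d : ℝ}

lemma prob_allChildren (hd : 0 < d) {E : Set (List ℕ → ℕ)} (hE : MeasurableSet E) :
    (poissonTree d).real (allChildren E) = Real.exp (-(d * (1 - (poissonTree d).real E))) :=
  poissonTree_forall_children hd hE (measurableSet_allChildren hE) fun _ => Iff.rfl

lemma prob_someChild (hd : 0 < d) {E : Set (List ℕ → ℕ)} (hE : MeasurableSet E) :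
    (poissonTree d).real (someChild E) = 1 - Real.exp (-(d * (poissonTree d).real E)) := by
  have h := prob_allChildren hd hE.compl
  rw [← compl_someChild, probReal_compl_eq_one_sub (measurableSet_someChild hE),
    probReal_compl_eq_one_sub hE, sub_sub_cancel] at h
  linarith

lemma prob_losesIn_succ (hd : 0 < d) (n : ℕ) : (poissonTree d).real (losesIn (n + 1)) =
    Real.exp (-(d * Real.exp (-(d * (poissonTree d).real (losesIn n))))) := by
  rw [losesIn, prob_allChildren hd (measurableSet_someChild (measurableSet_losesIn n)),
    prob_someChild hd (measurableSet_losesIn n), sub_sub_cancel]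

lemma prob_win (hd : 0 < d) : (poissonTree d).real win =
    1 - Real.exp (-(d * (poissonTree d).real lose)) :=
  prob_someChild hd measurableSet_lose

lemma prob_lose (hd : 0 < d) : (poissonTree d).real lose =
    Real.exp (-(d * Real.exp (-(d * (poissonTree d).real lose)))) := by
  conv_lhs => rw [lose_eq]
  rw [prob_allChildren hd measurableSet_win, prob_win hd, sub_sub_cancel]

lemma prob_draw (hd : 0 < d) : (poissonTree d).real draw =
    Real.exp (-(d * (poissonTree d).real lose)) - (poissonTree d).real lose := by
  rw [draw, probReal_compl_eq_one_sub (measurableSet_lose.union measurableSet_win),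
    measureReal_union disjoint_lose_win measurableSet_win, prob_win hd]
  ring

/-- The map `t ↦ exp (-d exp (-d t))` has derivative `d² exp (-d t) exp (-d exp (-d t))`. -/
lemma hasDerivAt_exp_exp (d t : ℝ) : HasDerivAt (fun t => Real.exp (-(d * Real.exp (-(d * t)))))
    (d ^ 2 * Real.exp (-(d * t)) * Real.exp (-(d * Real.exp (-(d * t))))) t := by
  have h1 : HasDerivAt (fun t => Real.exp (-(d * t))) (Real.exp (-(d * t)) * -(d * 1)) t :=
    (((hasDerivAt_id t).const_mul d).neg).exp
  have h2 := ((h1.const_mul d).neg).exp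
  convert! h2 using 1
  simp only [Pi.neg_apply]
  ring

/-- Below `e`, the map `t ↦ exp (-d t)` has no cycle of length two. -/
lemma eq_of_two_cycle (hd : 0 < d) (hde : d < Real.exp 1) {x y : ℝ}
    (hx : x = Real.exp (-(d * y))) (hy : y = Real.exp (-(d * x))) : x = y := by
  wlog hxy : x ≤ y generalizing x y
  · exact (this hy hx (le_of_not_ge hxy)).symm
  refine hxy.eq_or_lt.resolve_right fun hlt => ?_
  -- Two distinct fixed points of F(t) = exp(-d exp(-d t)) would force F' = 1 between them. But F' =
  -- d · (d u e^{-d u}) with u = e^{-d z}, and s e^{-s} ≤ 1/e bounds this by d/e < 1.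
  obtain ⟨z, -, hz⟩ := exists_hasDerivAt_eq_slope
    (fun t => Real.exp (-(d * Real.exp (-(d * t))))) _ hlt
    (fun t _ => (hasDerivAt_exp_exp d t).continuousAt.continuousWithinAt)
    (fun t _ => hasDerivAt_exp_exp d t)
  rw [← hx, ← hy, ← hx, div_self (sub_ne_zero.2 hlt.ne')] at hz
  have hu : 0 < Real.exp (-(d * z)) := Real.exp_pos _
  generalize Real.exp (-(d * z)) = u at hz hu
  have h1 : d * u ≤ Real.exp (d * u - 1) := by linarith [Real.add_one_le_exp (d * u - 1)]
  have h2 : d * u * Real.exp (-(d * u)) ≤ Real.exp (-1) := by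
    calc _ ≤ Real.exp (d * u - 1) * Real.exp (-(d * u)) := by gcongr
      _ = Real.exp (-1) := by rw [← Real.exp_add]; ring_nf
  have h3 : d * Real.exp (-1) < 1 := by
    rw [Real.exp_neg, ← div_eq_mul_inv, div_lt_one (Real.exp_pos _)]; exact hde
  nlinarith

lemma prob_lose_fixed (hd : 0 < d) (hde : d < Real.exp 1) :
    (poissonTree d).real lose = Real.exp (-(d * (poissonTree d).real lose)) :=
  eq_of_two_cycle hd hde (prob_lose hd) rfl

/-- Above `e`, draws occur. -/
lemma prob_draw_pos (hde : Real.exp 1 < d) : 0 < (poissonTree d).real draw := by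
  have hd : 0 < d := (Real.exp_pos 1).trans hde
  refine measureReal_nonneg.lt_of_ne' fun h => ?_
  rw [prob_draw hd, sub_eq_zero] at h
  have hx := prob_lose hd
  set x := (poissonTree d).real lose with hxdef
  have hx0 : 0 < x := by rw [← h]; exact Real.exp_pos _
  have hy : d * x * Real.exp (d * x) = d := by
    have : x * Real.exp (d * x) = 1 := by
      conv_lhs => rw [← h]
      rw [← Real.exp_add, h]; simp
    rw [mul_assoc, this, mul_one]
  have hy1 : 1 < d * x := by
    by_contra! hle
    have : d * x * Real.exp (d * x) ≤ 1 * Real.exp 1 := by gcongr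
    rw [hy] at this; linarith
  -- If there were no draws, x would be fixed by exp(-d t), so F'(x) = (d x)², which exceeds 1.
  -- Hence F(t) < t for some t in (0, x).
  have hder := hasDerivAt_exp_exp d x
  rw [h, h] at hder
  have hslope := (hasDerivAt_iff_tendsto_slope.1 hder).eventually
    (lt_mem_nhds (show 1 < d ^ 2 * x * x by nlinarith))
  have hev : ∀ᶠ t in nhdsWithin x (Set.Iio x),
      1 < slope (fun t => Real.exp (-(d * Real.exp (-(d * t))))) x t :=
    hslope.filter_mono (nhdsWithin_mono _ fun t ht => (Set.mem_Iio.1 ht).ne)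
  have hpos : ∀ᶠ t in nhdsWithin x (Set.Iio x), t ∈ Set.Ioo 0 x := Ioo_mem_nhdsLT hx0
  obtain ⟨t, ht, ht0, htx⟩ := (hev.and hpos).exists
  rw [slope_def_field, h, h, lt_div_iff_of_neg (by linarith)] at ht
  -- F is increasing and F(t) < t, so its iterates from 0 never pass t, although they converge to x
  -- > t.
  have hbound : ∀ n, (poissonTree d).real (losesIn n) ≤ t := by
    intro n
    induction n with
    | zero => simpa [losesIn] using ht0.le
    | succ n ih =>
      rw [prob_losesIn_succ hd]
      calc _ ≤ Real.exp (-(d * Real.exp (-(d * t)))) := by gcongr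
        _ ≤ t := by linarith
  have hlim : Filter.Tendsto (fun n => (poissonTree d).real (losesIn n)) Filter.atTop (nhds x) :=
    (ENNReal.tendsto_toReal (measure_ne_top _ _)).comp (tendsto_measure_iUnion_atTop losesIn_mono)
  exact absurd (le_of_tendsto' hlim hbound) (not_le.2 htx)

/-- With y = d x the fixed-point equation reads y e^y = d; the left side increases in y ≥ 0 and
equals the threshold at y = 1/√2. -/
lemma mul_prob_lose_lt (hd : 0 < d) (hdt : d < Real.exp (1 / √2) / √2) (hde : d < Real.exp 1) :
    d * (poissonTree d).real lose < 1 / √2 := by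
  have h := prob_lose_fixed hd hde
  set x := (poissonTree d).real lose
  have hy : d * x * Real.exp (d * x) = d := by
    have : x * Real.exp (d * x) = 1 := by
      nth_rewrite 1 [h]
      rw [← Real.exp_add]; simp
    rw [mul_assoc, this, mul_one]
  by_contra! hle
  have : 1 / √2 * Real.exp (1 / √2) ≤ d * x * Real.exp (d * x) := by gcongr
  rw [hy, one_div_mul_eq_div] at this
  linarith

/-- All children of a lost vertex are won, so the cluster can continue only through a won child; the
other children contribute exp(-d (1 - P(win))) = P(lose). -/
lemma prob_lose_inter_reach_succ_le (hd : 0 < d) (hde : d < Real.exp 1) (n : ℕ) :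
    (poissonTree d).real (lose ∩ reach (n + 1)) ≤
      d * (poissonTree d).real lose * (poissonTree d).real (win ∩ reach n) := by
  have hF : ∀ c ∈ lose ∩ reach (n + 1), ∃ i < c [], shift [i] c ∈ win ∩ reach n ∧
      ∀ j < c [], j ≠ i → shift [j] c ∈ win := by
    rintro c ⟨hl, -, i, hi, hr⟩
    rw [lose_eq] at hl
    exact ⟨i, hi, ⟨hl i hi, hr⟩, fun j hj _ => hl j hj⟩
  have h := poissonTree_exists_child_le hd (measurableSet_win.inter (measurableSet_reach n))
    measurableSet_win (measurableSet_lose.inter (measurableSet_reach (n + 1))) hF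
  rw [prob_win hd, sub_sub_cancel, ← prob_lose_fixed hd hde, ← prob_lose_fixed hd hde] at h
  linarith

lemma prob_compl_lose_inter_le (hd : 0 < d) (hde : d < Real.exp 1) {E : Set (List ℕ → ℕ)} :
    (poissonTree d).real (loseᶜ ∩ E) ≤ (poissonTree d).real (win ∩ E) := by
  have h0 : (poissonTree d).real draw = 0 := by
    rw [prob_draw hd, ← prob_lose_fixed hd hde, sub_self]
  have hsub : loseᶜ ∩ E ⊆ (win ∩ E) ∪ draw := by
    rintro c ⟨h1, h2⟩
    by_cases hw : c ∈ win
    · exact .inl ⟨hw, h2⟩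
    · exact .inr fun h => h.elim h1 hw
  refine (measureReal_mono hsub (measure_ne_top _ _)).trans ((measureReal_union_le _ _).trans ?_)
  rw [h0, add_zero]

/-- A won vertex of the cluster has exactly one lost child. The cluster continues either through
that child (first term) or through another, almost surely won, child (second term). -/
lemma prob_win_inter_reach_succ_le (hd : 0 < d) (hde : d < Real.exp 1) (n : ℕ) :
    (poissonTree d).real (win ∩ reach (n + 1)) ≤
      d * (poissonTree d).real lose * (poissonTree d).real (lose ∩ reach n) +
      (d * (poissonTree d).real lose) ^ 2 * (poissonTree d).real (win ∩ reach n) := by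
  set F := win ∩ reach (n + 1) with hFdef
  have hFm : MeasurableSet F := measurableSet_win.inter (measurableSet_reach (n + 1))
  set G : Set (List ℕ → ℕ) := {c | ∃ i < c [], shift [i] c ∈ lose ∩ reach n} with hG
  have hGm : MeasurableSet G := measurableSet_someChild
    (measurableSet_lose.inter (measurableSet_reach n))
  have hFu : ∀ c ∈ F, ∃ j < c [], shift [j] c ∈ lose ∧
      ∀ k < c [], k ≠ j → shift [k] c ∈ loseᶜ := by
    rintro c ⟨⟨j, hj, hjl⟩, hr⟩
    refine ⟨j, hj, hjl, fun k hk hkj hkl => reach_subset _ hr ⟨k, hk, j, hj, hkj, hkl, hjl⟩⟩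
  have h1 : ∀ c ∈ F ∩ G, ∃ i < c [], shift [i] c ∈ lose ∩ reach n ∧
      ∀ j < c [], j ≠ i → shift [j] c ∈ loseᶜ := by
    rintro c ⟨hF, i, hi, hir⟩
    obtain ⟨j, hj, hjl, hu⟩ := hFu c hF
    by_cases hij : i = j
    · subst hij; exact ⟨i, hi, hir, hu⟩
    · exact absurd hir.1 (hu i hi hij)
  have h2 : ∀ c ∈ F ∩ Gᶜ, ∃ i < c [], ∃ j < c [], j ≠ i ∧ shift [i] c ∈ loseᶜ ∩ reach n ∧
      shift [j] c ∈ lose ∧ ∀ k < c [], k ≠ i → k ≠ j → shift [k] c ∈ loseᶜ := by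
    rintro c ⟨hF, hG⟩
    obtain ⟨j, hj, hjl, hu⟩ := hFu c hF
    obtain ⟨-, -, i, hi, hir⟩ := hF
    have hil : shift [i] c ∉ lose := fun h => hG ⟨i, hi, h, hir⟩
    exact ⟨i, hi, j, hj, fun h => hil (h ▸ hjl), ⟨hil, hir⟩, hjl, fun k hk _ hkj => hu k hk hkj⟩
  have hlc := measurableSet_lose.compl
  have b1 := poissonTree_exists_child_le hd (measurableSet_lose.inter (measurableSet_reach n))
    hlc (hFm.inter hGm) h1
  have b2 := poissonTree_exists_two_children_le hd (hlc.inter (measurableSet_reach n))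
    measurableSet_lose hlc (hFm.inter hGm.compl) h2
  rw [probReal_compl_eq_one_sub measurableSet_lose, sub_sub_cancel,
    ← prob_lose_fixed hd hde] at b1 b2
  have hsplit : (poissonTree d).real F =
      (poissonTree d).real (F ∩ G) + (poissonTree d).real (F ∩ Gᶜ) := by
    rw [← measureReal_inter_add_sdiff hGm, Set.sdiff_eq]
  have b3 := prob_compl_lose_inter_le hd hde (E := reach n)
  have b4 : d ^ 2 * ((poissonTree d).real (loseᶜ ∩ reach n) * (poissonTree d).real lose) *
      (poissonTree d).real lose ≤
      (d * (poissonTree d).real lose) ^ 2 * (poissonTree d).real (win ∩ reach n) := by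
    calc _ = (d * (poissonTree d).real lose) ^ 2 * (poissonTree d).real (loseᶜ ∩ reach n) := by ring
      _ ≤ _ := by gcongr
  rw [hsplit]
  linarith

/-- Below the threshold, the cluster of vertices without two lost children is finite. -/
lemma prob_iInter_reach (hd : 0 < d) (hdt : d < Real.exp (1 / √2) / √2) (hde : d < Real.exp 1) :
    (poissonTree d).real (⋂ n, reach n) = 0 := by
  have hy := mul_prob_lose_lt hd hdt hde
  set y := d * (poissonTree d).real lose with hydef
  have hy0 : 0 ≤ y := by positivity
  set q := 2 * y ^ 2 with hq
  have hq0 : 0 ≤ q := by positivity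
  have hq1 : q < 1 := by
    have h2 : (1 / √2) ^ 2 = 1 / 2 := by rw [div_pow, Real.sq_sqrt (by norm_num)]; norm_num
    have : y ^ 2 < (1 / √2) ^ 2 := by gcongr
    linarith
  have hy1 : y ≤ 1 := by nlinarith
  have hα := prob_lose_inter_reach_succ_le hd hde
  have hβ := prob_win_inter_reach_succ_le hd hde
  rw [← hydef] at hα hβ
  set β := fun n => (poissonTree d).real (win ∩ reach n) with hβdef
  have hrec : ∀ n, β (n + 2) ≤ y ^ 2 * (β (n + 1) + β n) := by
    intro n
    have h1 := hβ (n + 1)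
    have h2 := mul_le_mul_of_nonneg_left (hα n) hy0
    simp only [β]
    linarith
  -- The recursion expresses β(n+2) through the two previous terms with total weight q = 2 y² < 1,
  -- so every two levels gain a factor q.
  have hgeo : ∀ k, β (2 * k) ≤ q ^ k ∧ β (2 * k + 1) ≤ q ^ k := by
    intro k
    induction k with
    | zero => exact ⟨by simpa using measureReal_le_one, by simpa using measureReal_le_one⟩
    | succ k ih =>
      have hqk : 0 ≤ q ^ k := by positivity
      have e1 := hrec (2 * k)
      have e2 := hrec (2 * k + 1)
      have f1 : β (2 * (k + 1)) ≤ q ^ (k + 1) := by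
        refine e1.trans ?_
        calc _ ≤ y ^ 2 * (q ^ k + q ^ k) := by gcongr; exacts [ih.2, ih.1]
          _ = _ := by rw [pow_succ, hq]; ring
      have hk : q ^ (k + 1) ≤ q ^ k := pow_le_pow_of_le_one hq0 hq1.le (Nat.le_succ k)
      refine ⟨f1, e2.trans ?_⟩
      calc _ ≤ y ^ 2 * (q ^ (k + 1) + q ^ k) := by gcongr; exacts [f1, ih.2]
        _ ≤ y ^ 2 * (q ^ k + q ^ k) := mul_le_mul_of_nonneg_left
            (by linarith) (by positivity)
        _ = _ := by rw [pow_succ, hq]; ring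
  have hle : ∀ k, (poissonTree d).real (⋂ n, reach n) ≤ q ^ k + q ^ k := by
    intro k
    have hs : (⋂ n, reach n) ⊆ (lose ∩ reach (2 * k + 1)) ∪ (loseᶜ ∩ reach (2 * k + 1)) := by
      rw [← Set.union_inter_distrib_right, Set.union_compl_self, Set.univ_inter]
      exact Set.iInter_subset _ _
    refine (measureReal_mono hs (measure_ne_top _ _)).trans ((measureReal_union_le _ _).trans ?_)
    refine add_le_add ((hα _).trans ?_) ((prob_compl_lose_inter_le hd hde).trans (hgeo k).2)
    calc y * β (2 * k) ≤ 1 * q ^ k := by gcongr; exact (hgeo k).1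
      _ = q ^ k := one_mul _
  have hlim := tendsto_pow_atTop_nhds_zero_of_lt_one hq0 hq1
  have := ge_of_tendsto' (hlim.add hlim) hle
  exact le_antisymm (by simpa using this) measureReal_nonneg

lemma ae_exists_notMem_reach (hd : 0 < d) (hdt : d < Real.exp (1 / √2) / √2)
    (hde : d < Real.exp 1) :
    ∀ᵐ c ∂(poissonTree d), ∀ l, ∃ n, shift l c ∉ reach n := by
  rw [ae_all_iff]
  intro l
  have h0 : ∀ᵐ c ∂(poissonTree d), c ∉ ⋂ n, reach n :=
    measure_eq_zero_iff_ae_notMem.1 ((measureReal_eq_zero_iff (measure_ne_top _ _)).1 (prob_iInter_reach hd hdt hde))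
  have := (measurePreserving_shift (d := d) l).quasiMeasurePreserving.ae h0
  filter_upwards [this] with c hc
  simpa using hc

/-- Above `e`, the root has exactly two children, both of them drawn, with positive probability. -/
lemma prob_two_draws_pos (hde : Real.exp 1 < d) :
    0 < (poissonTree d).real {c | c [] = 2 ∧ ∀ i < 2, shift [i] c ∈ draw} := by
  have hd : 0 < d := (Real.exp_pos 1).trans hde
  rw [poissonTree_branching hd 2 (E := fun _ => draw) fun _ => measurableSet_draw]
  have := prob_draw_pos hde
  have := poissonWeight_pos hd 2
  positivity

end Probability

end HardCore

namespace HardCore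

open MeasureTheory ProbabilityTheory

/-! ### Infinite trees and branching of their infinite part -/

section Survival

/-- The trees that have a vertex at distance `n` from the root. -/
def heightGe : ℕ → Set (List ℕ → ℕ)
  | 0 => Set.univ
  | n + 1 => someChild (heightGe n)

/-- The trees that have vertices at every distance from the root. -/
def survive : Set (List ℕ → ℕ) := ⋂ n, heightGe n

lemma heightGe_anti : Antitone heightGe := by
  refine antitone_nat_of_succ_le fun n => ?_
  induction n with
  | zero => exact Set.subset_univ _
  | succ n ih => exact someChild_mono ih

lemma measurableSet_heightGe (n : ℕ) : MeasurableSet (heightGe n) := by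
  induction n with
  | zero => exact .univ
  | succ n ih => exact measurableSet_someChild ih

lemma measurableSet_survive : MeasurableSet survive := .iInter measurableSet_heightGe

/-- König's lemma: if every child subtree had finite height, the maximum over the finitely many
children would bound the whole tree. -/
lemma survive_eq : survive = someChild survive := by
  have h : Monotone fun n => (heightGe n)ᶜ := fun m n hmn => Set.compl_subset_compl.2 (heightGe_anti hmn)
  rw [← compl_inj_iff, compl_someChild, survive, Set.compl_iInter, allChildren_iUnion h]
  simp_rw [← compl_someChild]
  refine Set.Subset.antisymm (Set.iUnion_subset fun n => ?_) (Set.iUnion_subset fun n => ?_)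
  · cases n with
    | zero => simp [heightGe]
    | succ n => exact Set.subset_iUnion (fun n => (someChild (heightGe n))ᶜ) n
  · exact Set.subset_iUnion (fun n => (heightGe n)ᶜ) (n + 1)

lemma inTree_append (c : List ℕ → ℕ) (m l : List ℕ) :
    InTree c (m ++ l) ↔ InTree c l ∧ InTree (shift l c) m := by
  induction m with
  | nil => simp [InTree]
  | cons i m ih =>
    simp only [List.cons_append, InTree, ih]
    exact ⟨fun ⟨a, b, c⟩ => ⟨b, a, c⟩, fun ⟨a, b, c⟩ => ⟨b, a, c⟩⟩

lemma measurableSet_inTree (l : List ℕ) : MeasurableSet {c | InTree c l} := by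
  induction l with
  | nil => exact .univ
  | cons i l ih =>
    exact (measurableSet_lt measurable_const (measurable_pi_apply _)).inter ih

/-- The infinite trees in which no vertex has two children with infinite subtrees. -/
def thin : Set (List ℕ → ℕ) :=
  survive ∩ {c | ∀ l, InTree c l → shift l c ∉ twoChildren survive}

lemma measurableSet_thin : MeasurableSet thin := by
  refine measurableSet_survive.inter ?_
  have : {c | ∀ l, InTree c l → shift l c ∉ twoChildren survive} =
      ⋂ l, ({c | InTree c l}ᶜ ∪ shift l ⁻¹' (twoChildren survive)ᶜ) := by
    ext c
    simp only [Set.mem_iInter, Set.mem_ofPred_eq, Set.mem_union, Set.mem_compl_iff,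
      Set.mem_preimage, imp_iff_not_or]
  rw [this]
  exact .iInter fun l => (measurableSet_inTree l).compl.union
    (measurable_shift l (measurableSet_twoChildren measurableSet_survive).compl)

lemma thin_child {c : List ℕ → ℕ} (hc : c ∈ thin) :
    ∃ i < c [], shift [i] c ∈ thin ∧ ∀ j < c [], j ≠ i → shift [j] c ∈ surviveᶜ := by
  obtain ⟨hs, ht⟩ := hc
  rw [survive_eq] at hs
  obtain ⟨i, hi, hsi⟩ := hs
  refine ⟨i, hi, ⟨hsi, fun l hl => ?_⟩, fun j hj hji hsj => ?_⟩
  · rw [shift_shift]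
    exact ht _ ((inTree_append c l [i]).2 ⟨⟨hi, trivial⟩, hl⟩)
  · exact ht [] trivial (by rw [shift_nil]; exact ⟨i, hi, j, hj, hji.symm, hsi, hsj⟩)

variable {d : ℝ}

/-- Infinite Poisson trees branch into two infinite subtrees somewhere. -/
lemma prob_thin (hd : 0 < d) : (poissonTree d).real thin = 0 := by
  have h := poissonTree_exists_child_le hd measurableSet_thin measurableSet_survive.compl
    measurableSet_thin fun c hc => thin_child hc
  have hs : (poissonTree d).real survive = 1 - Real.exp (-(d * (poissonTree d).real survive)) := by
    conv_lhs => rw [survive_eq]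
    exact prob_someChild hd measurableSet_survive
  have hle : (poissonTree d).real thin ≤ (poissonTree d).real survive :=
    measureReal_mono Set.inter_subset_left (measure_ne_top _ _)
  rw [probReal_compl_eq_one_sub measurableSet_survive, sub_sub_cancel] at h
  set s := (poissonTree d).real survive with hsdef
  have hs0 : 0 ≤ s := measureReal_nonneg
  have hq0 : 0 ≤ (poissonTree d).real thin := measureReal_nonneg
  -- If s = 0 the event is null since it lies in `survive`. Otherwise e^{ds} > 1 + ds and s = 1 -
  -- e^{-ds} give d e^{-ds} < 1, so q ≤ d e^{-ds} q forces q = 0 for the probability q of `thin`.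
  rcases hs0.eq_or_lt with h0 | h0
  · linarith
  · have h1 : d * s + 1 < Real.exp (d * s) := Real.add_one_lt_exp (by positivity)
    have h2 : Real.exp (d * s) * Real.exp (-(d * s)) = 1 := by rw [← Real.exp_add]; simp
    have h3 : 0 < Real.exp (-(d * s)) := Real.exp_pos _
    generalize Real.exp (-(d * s)) = η at *
    generalize Real.exp (d * s) = w at *
    have h4 : d * η < 1 := by
      have : (d * s + 1) * η < w * η := by gcongr
      rw [h2] at this
      have h5 : d * η * s < 1 * s := by nlinarith
      exact lt_of_mul_lt_mul_right h5 h0.le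
    nlinarith

lemma ae_exists_branching (hd : 0 < d) : ∀ᵐ c ∂(poissonTree d), c ∈ survive →
    ∃ l, InTree c l ∧ shift l c ∈ twoChildren survive := by
  have h0 : ∀ᵐ c ∂(poissonTree d), c ∉ thin :=
    measure_eq_zero_iff_ae_notMem.1 ((measureReal_eq_zero_iff (measure_ne_top _ _)).1 (prob_thin hd))
  filter_upwards [h0] with c hc hs
  by_contra! hcon
  exact hc ⟨hs, hcon⟩

end Survival

/-! ### Finiteness of levels; infinite means of unbounded height -/

section Levels

variable (c : List ℕ → ℕ)

lemma mem_heightGe_iff (n : ℕ) (c : List ℕ → ℕ) :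
    c ∈ heightGe n ↔ ∃ l, InTree c l ∧ l.length = n := by
  induction n generalizing c with
  | zero => exact ⟨fun _ => ⟨[], trivial, rfl⟩, fun _ => trivial⟩
  | succ n ih =>
    constructor
    · rintro ⟨i, hi, h⟩
      obtain ⟨l, hl, rfl⟩ := (ih _).1 h
      exact ⟨l ++ [i], (inTree_append c l [i]).2 ⟨⟨hi, trivial⟩, hl⟩, by simp⟩
    · rintro ⟨l, hl, hn⟩
      obtain ⟨m, i, rfl⟩ : ∃ m i, l = m ++ [i] := by
        rcases List.eq_nil_or_concat l with rfl | ⟨m, i, rfl⟩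
        · simp at hn
        · exact ⟨m, i, by simp⟩
      obtain ⟨h1, h2⟩ := (inTree_append c m [i]).1 hl
      exact ⟨i, h1.1, (ih _).2 ⟨m, h2, by simpa using hn⟩⟩

lemma finite_level (n : ℕ) : {l | InTree c l ∧ l.length = n}.Finite := by
  induction n with
  | zero =>
    refine (Set.finite_singleton []).subset ?_
    rintro l ⟨-, hl⟩
    exact List.length_eq_zero_iff.1 hl
  | succ n ih =>
    refine (ih.biUnion fun l _ => (Set.finite_lt_nat (c l)).image fun i => i :: l).subset ?_
    rintro (_ | ⟨i, l⟩) ⟨h1, h2⟩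
    · simp at h2
    · simp only [Set.mem_iUnion]
      exact ⟨l, ⟨h1.2, by simpa using h2⟩, i, h1.1, rfl⟩

lemma finite_ball (n : ℕ) : {v : Vertex c | v.1.length ≤ n}.Finite := by
  have h : {l | InTree c l ∧ l.length ≤ n}.Finite := by
    refine ((Set.finite_le_nat n).biUnion fun k _ => finite_level c k).subset ?_
    rintro l ⟨h1, h2⟩
    simp only [Set.mem_iUnion]
    exact ⟨l.length, h2, h1, rfl⟩
  refine Set.Finite.of_finite_image (f := Subtype.val) (h.subset ?_) Subtype.val_injective.injOn
  rintro _ ⟨v, hv, rfl⟩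
  exact ⟨v.2, hv⟩

lemma inTree_of_append {m l : List ℕ} (h : InTree c (m ++ l)) : InTree c l :=
  ((inTree_append c m l).1 h).1

lemma infinite_vertex_iff : Infinite (Vertex c) ↔ c ∈ survive := by
  constructor
  · intro h
    refine Set.mem_iInter.2 fun n => (mem_heightGe_iff n c).2 ?_
    by_contra! hcon
    refine h.not_finite (Set.finite_univ_iff.1 ((finite_ball c n).subset fun v _ => ?_))
    by_contra hv
    have hv : n ≤ v.1.length := by simpa using (not_le.1 hv).le
    have h2 : InTree c (v.1.drop (v.1.length - n)) :=
      inTree_of_append c (m := v.1.take (v.1.length - n)) (by rw [List.take_append_drop]; exact v.2)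
    exact hcon _ h2 (by rw [List.length_drop]; omega)
  · intro h
    have : ∀ n, ∃ v : Vertex c, v.1.length = n := fun n => by
      obtain ⟨l, hl, hn⟩ := (mem_heightGe_iff n c).1 (Set.mem_iInter.1 h n)
      exact ⟨⟨l, hl⟩, hn⟩
    exact Infinite.of_surjective (fun v : Vertex c => v.1.length) this

end Levels

end HardCore

namespace HardCore

/-! ### Exchange argument for maximum configurations on trees -/

section Exchange

variable {c : List ℕ → ℕ}

/-- `w` is a child of `v`. -/
def IsChild (v w : Vertex c) : Prop := ∃ i : ℕ, w.1 = i :: v.1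

lemma tree_adj {v w : Vertex c} : (tree c).Adj v w ↔ IsChild v w ∨ IsChild w v := Iff.rfl

lemma IsChild.length {v w : Vertex c} (h : IsChild v w) : w.1.length = v.1.length + 1 := by
  obtain ⟨i, h⟩ := h
  rw [h, List.length_cons]

lemma IsChild.parent_unique {u v w : Vertex c} (h : IsChild u w) (h' : IsChild v w) : u = v := by
  obtain ⟨i, h⟩ := h
  obtain ⟨j, h'⟩ := h'
  rw [h] at h'
  exact Subtype.ext (List.cons.inj h').2

lemma isIndepSet_tree_iff {s : Set (Vertex c)} :
    (tree c).IsIndepSet s ↔ ∀ v ∈ s, ∀ w ∈ s, ¬ IsChild v w := by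
  constructor
  · intro h v hv w hw hvw
    exact h hv hw (fun e => by subst e; simpa using hvw.length) (tree_adj.2 (.inl hvw))
  · intro h v hv w hw _ hadj
    exact hadj.elim (h v hv w hw) (h w hw v hv)

lemma mem_admissible {V : Type*} {G : SimpleGraph V} {Ψ : Finset V} {σ : Set V} {S : Finset V} :
    S ∈ admissible G Ψ σ ↔ S ⊆ Ψ ∧ G.IsIndepSet (↑S ∪ σ) := by
  simp [admissible]

lemma mem_maxConfigs {V : Type*} {G : SimpleGraph V} {Ψ : Finset V} {σ : Set V} {S : Finset V} :
    S ∈ maxConfigs G Ψ σ ↔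
      S ∈ admissible G Ψ σ ∧ ∀ S' ∈ admissible G Ψ σ, S'.card ≤ S.card := by
  simp [maxConfigs]

/-- The vertices reached from `X` by alternately moving to a child in `S` and along `g`. -/
inductive Alternating (S : Finset (Vertex c)) (g : Vertex c → Vertex c) (X : Finset (Vertex c)) :
    Vertex c → Prop
  | base (x : Vertex c) : x ∈ X → Alternating S g X x
  | step (a w : Vertex c) : Alternating S g X a → IsChild a w → w ∈ S → Alternating S g X (g w)

/-- A set `L` of vertices of a patch witnesses lost positions, relative to a boundary condition,
if all children of its vertices are unoccupied or have a child that is occupied or in `L`. -/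
def IsLosing (Ψ : Finset (Vertex c)) (σ L : Set (Vertex c)) : Prop :=
  ∀ v ∈ L, v ∈ Ψ ∧ ∀ w, IsChild v w → w ∉ σ ∧ (w ∈ Ψ → ∃ x, IsChild w x ∧ (x ∈ L ∨ x ∈ σ))

/-- Lost positions can be made occupied along alternating trees, at the cost of their parents. -/
lemma exists_exchange {Ψ : Finset (Vertex c)} {σ L : Set (Vertex c)} (hL : IsLosing Ψ σ L)
    {S : Finset (Vertex c)} (hS : S ∈ admissible (tree c) Ψ σ) {X U : Finset (Vertex c)} {k : ℕ}
    (hXL : ∀ x ∈ X, x ∈ L) (hXk : ∀ x ∈ X, x.1.length = k) (hXS : ∀ x ∈ X, x ∉ S)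
    (hXσ : ∀ u ∈ σ, ∀ x ∈ X, ¬ IsChild u x) (hU : ∀ u ∈ S, ∀ x ∈ X, IsChild u x → u ∈ U) :
    ∃ S' ∈ admissible (tree c) Ψ σ, S.card + X.card ≤ S'.card + U.card := by
  classical
  obtain ⟨hSΨ, hind⟩ := mem_admissible.1 hS
  rw [isIndepSet_tree_iff] at hind
  -- The witness below an occupied `w` cannot lie in `σ`, by independence, so it lies in `L` and can
  -- replace `w`.
  have hg : ∀ w, w ∈ S → (∃ v ∈ L, IsChild v w) → ∃ x, x ∈ L ∧ IsChild w x := by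
    rintro w hw ⟨v, hv, hvw⟩
    obtain ⟨x, hx, h | h⟩ := ((hL v hv).2 w hvw).2 (hSΨ hw)
    · exact ⟨x, h, hx⟩
    · exact absurd hx (hind w (.inl hw) x (.inr h))
  choose! g hgL hgc using hg
  have hR : ∀ a, Alternating S g X a → a ∈ L ∧ a ∉ S ∧ ∃ m, a.1.length = k + 2 * m := by
    intro a ha
    induction ha with
    | base x hx => exact ⟨hXL x hx, hXS x hx, 0, hXk x hx⟩
    | step a w _ haw hw ih =>
      obtain ⟨h1, -, m, hm⟩ := ih
      have hc := hgc w hw ⟨a, h1, haw⟩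
      refine ⟨hgL w hw ⟨a, h1, haw⟩, fun h => hind w (.inl hw) _ (.inl h) hc, m + 1, ?_⟩
      rw [hc.length, haw.length, hm]; ring
  set A := Ψ.filter (Alternating S g X) with hA
  set B := S.filter (fun w => ∃ a, Alternating S g X a ∧ IsChild a w) with hB
  have memA : ∀ a, a ∈ A ↔ Alternating S g X a := fun a => by
    rw [hA, Finset.mem_filter]
    exact ⟨fun h => h.2, fun h => ⟨(hL a (hR a h).1).1, h⟩⟩
  have hBc : ∀ w ∈ B, IsChild w (g w) := by
    intro w hw
    obtain ⟨hw, a, ha, haw⟩ := Finset.mem_filter.1 hw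
    exact hgc w hw ⟨a, (hR a ha).1, haw⟩
  -- Each removed `w ∈ B` is compensated by its own child `g w`, and `X` is a net gain: it lies at
  -- level `k`, every `g w` at a deeper level of the same parity.
  have hcard : A.card = X.card + B.card := by
    have hAe : A = X ∪ B.image g := by
      ext a
      rw [memA, Finset.mem_union, Finset.mem_image]
      constructor
      · intro h
        cases h with
        | base x hx => exact .inl hx
        | step a w ha haw hw => exact .inr ⟨w, Finset.mem_filter.2 ⟨hw, a, ha, haw⟩, rfl⟩
      · rintro (h | ⟨w, hw, rfl⟩)
        · exact .base a h
        · obtain ⟨hw, a, ha, haw⟩ := Finset.mem_filter.1 hw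
          exact .step a w ha haw hw
    rw [hAe, Finset.card_union_of_disjoint, Finset.card_image_of_injOn]
    · intro w hw w' hw' h
      have h1 := hBc w hw
      rw [h] at h1
      exact h1.parent_unique (hBc w' hw')
    · refine Finset.disjoint_left.2 fun x hx hx' => ?_
      obtain ⟨w, hw, rfl⟩ := Finset.mem_image.1 hx'
      have h1 := (hBc w hw).length
      obtain ⟨-, a, ha, haw⟩ := Finset.mem_filter.1 hw
      obtain ⟨-, -, m, hm⟩ := hR a ha
      have := haw.length
      have := hXk _ hx
      omega
  have hdisj : Disjoint (S \ (B ∪ U)) A := by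
    refine Finset.disjoint_left.2 fun a ha ha' => ?_
    exact (hR a ((memA a).1 ha')).2.1 (Finset.mem_sdiff.1 ha).1
  -- Independence holds because `A` occupies levels of one parity, while the occupied children of
  -- `A` (which form `B`) and the occupied parents of `A` (in `B` or `U`) are removed.
  refine ⟨(S \ (B ∪ U)) ∪ A, mem_admissible.2 ⟨?_, isIndepSet_tree_iff.2 ?_⟩, ?_⟩
  · exact Finset.union_subset (Finset.sdiff_subset.trans hSΨ) (Finset.filter_subset _ _)
  · have key : ∀ u ∈ (↑(S \ (B ∪ U) ∪ A) ∪ σ : Set (Vertex c)),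
        (u ∈ S ∧ u ∉ B ∧ u ∉ U) ∨ Alternating S g X u ∨ u ∈ σ := by
      intro u hu
      simp only [Set.mem_union, Finset.mem_coe, Finset.mem_union, Finset.mem_sdiff, memA,
        not_or] at hu
      tauto
    have hupper : ∀ u v, (u ∈ S ∧ u ∉ B ∧ u ∉ U) ∨ u ∈ σ → Alternating S g X v → ¬ IsChild u v := by
      intro u v hu hv huv
      cases hv with
      | base x hx =>
        rcases hu with ⟨h1, -, h3⟩ | h
        · exact h3 (hU u h1 v hx huv)
        · exact hXσ u h v hx huv
      | step a w ha haw hw =>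
        have hwB : w ∈ B := Finset.mem_filter.2 ⟨hw, a, ha, haw⟩
        obtain rfl := huv.parent_unique (hBc w hwB)
        rcases hu with ⟨-, h2, -⟩ | h
        · exact h2 hwB
        · exact ((hL a (hR a ha).1).2 u haw).1 h
    intro u hu v hv huv
    rcases key u hu with hu | hu | hu <;> rcases key v hv with hv | hv | hv
    · exact hind u (.inl hu.1) v (.inl hv.1) huv
    · exact hupper u v (.inl hu) hv huv
    · exact hind u (.inl hu.1) v (.inr hv) huv
    · exact hv.2.1 (Finset.mem_filter.2 ⟨hv.1, u, hu, huv⟩)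
    · obtain ⟨-, -, m, hm⟩ := hR u hu
      obtain ⟨-, -, m', hm'⟩ := hR v hv
      have := huv.length
      omega
    · exact ((hL u (hR u hu).1).2 v huv).1 hv
    · exact hind u (.inr hu) v (.inl hv.1) huv
    · exact hupper u v (.inr hu) hv huv
    · exact hind u (.inr hu) v (.inr hv) huv
  · rw [Finset.card_union_of_disjoint hdisj, hcard]
    have h1 := Finset.le_card_sdiff (B ∪ U) S
    have h2 := Finset.card_union_le B U
    omega

/-- A lost position whose parent is unoccupied is occupied in every maximum configuration. -/
lemma mem_of_isLosing {Ψ : Finset (Vertex c)} {σ L : Set (Vertex c)} (hL : IsLosing Ψ σ L)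
    {S : Finset (Vertex c)} (hS : S ∈ maxConfigs (tree c) Ψ σ) {x : Vertex c} (hx : x ∈ L)
    (hxS : ∀ u, IsChild u x → u ∉ S ∧ u ∉ σ) : x ∈ S := by
  by_contra hcon
  obtain ⟨hadm, hmax⟩ := mem_maxConfigs.1 hS
  obtain ⟨S', hS', hcard⟩ := exists_exchange hL hadm (X := {x}) (U := ∅) (k := x.1.length)
    (by simpa using hx) (by simp) (by simpa using hcon)
    (fun u hu y hy h => (hxS u (Finset.mem_singleton.1 hy ▸ h)).2 hu)
    (fun u hu y hy h => absurd hu (hxS u (Finset.mem_singleton.1 hy ▸ h)).1)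
  have := hmax S' hS'
  simp at hcard
  omega

/-- A vertex with two lost children is unoccupied in every maximum configuration. -/
lemma notMem_of_isLosing {Ψ : Finset (Vertex c)} {σ L : Set (Vertex c)} (hL : IsLosing Ψ σ L)
    {S : Finset (Vertex c)} (hS : S ∈ maxConfigs (tree c) Ψ σ) {u x y : Vertex c}
    (hu : u ∉ σ) (hux : IsChild u x) (huy : IsChild u y) (hxy : x ≠ y) (hx : x ∈ L) (hy : y ∈ L) :
    u ∉ S := by
  classical
  intro huS
  obtain ⟨hadm, hmax⟩ := mem_maxConfigs.1 hS
  have hind := isIndepSet_tree_iff.1 (mem_admissible.1 hadm).2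
  have hpar : ∀ v, ∀ z ∈ ({x, y} : Finset (Vertex c)), IsChild v z → v = u := by
    intro v z hz hvz
    rcases Finset.mem_insert.1 hz with rfl | hz
    · exact hvz.parent_unique hux
    · obtain rfl := Finset.mem_singleton.1 hz
      exact hvz.parent_unique huy
  obtain ⟨S', hS', hcard⟩ := exists_exchange hL hadm (X := {x, y}) (U := {u})
    (k := u.1.length + 1) (by simpa using ⟨hx, hy⟩) (by simpa using ⟨hux.length, huy.length⟩)
    (by simpa using ⟨fun h => hind u (.inl huS) x (.inl h) hux,
      fun h => hind u (.inl huS) y (.inl h) huy⟩)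
    (fun v hv z hz h => hu (hpar v z hz h ▸ hv))
    (fun v _ z hz h => Finset.mem_singleton.2 (hpar v z hz h))
  have := hmax S' hS'
  rw [Finset.card_pair hxy, Finset.card_singleton] at hcard
  omega

end Exchange

/-! ### Screening by unoccupied vertices -/

section Marginal

variable {V : Type*} {G : SimpleGraph V}

lemma maxConfigs_nonempty {Ψ : Finset V} {σ : Set V} (hσ : G.IsIndepSet σ) :
    (maxConfigs G Ψ σ).Nonempty := by
  have h : (admissible G Ψ σ).Nonempty := ⟨∅, mem_admissible.2 ⟨Finset.empty_subset _, by simpa⟩⟩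
  obtain ⟨S, hS, hmax⟩ := Finset.exists_max_image _ Finset.card h
  exact ⟨S, mem_maxConfigs.2 ⟨hS, hmax⟩⟩

open Classical in
/-- If the boundary of a set `Φ` inside the patch is unoccupied in all maximum configurations, then
the configuration on `Φ` is distributed as in the patch `Φ` with free boundary. -/
lemma marginal_eq_of_boundary_unoccupied {Λ Φ Ψ : Finset V} {σ : Set V} (hΛ : Λ ⊆ Φ) (hΦ : Φ ⊆ Ψ)
    (hbd : ∀ v ∈ boundary G Φ, v ∈ Ψ) (hσ : IsBoundaryCondition G Ψ σ)
    (hun : ∀ S ∈ maxConfigs G Ψ σ, ∀ v ∈ boundary G Φ, v ∉ S) (A : Finset V) :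
    marginal G Ψ σ Λ A = marginal G Φ ∅ Λ A := by
  have hσΨ : ∀ v ∈ σ, v ∉ Ψ := fun v hv => (hσ.1 hv).1
  -- replacing the part of a maximum configuration in `Φ`
  have swap : ∀ S ∈ maxConfigs G Ψ σ, ∀ T ∈ admissible G Φ ∅,
      T ∪ S \ Φ ∈ admissible G Ψ σ ∧ (T ∪ S \ Φ).card = T.card + (S \ Φ).card := by
    intro S hS T hT
    obtain ⟨hTΦ, hTind⟩ := mem_admissible.1 hT
    obtain ⟨hSΨ, hSind⟩ := mem_admissible.1 (mem_maxConfigs.1 hS).1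
    rw [Set.union_empty] at hTind
    have hno : ∀ v ∈ T, ∀ w, w ∈ S \ Φ ∨ w ∈ σ → ¬ G.Adj v w := by
      intro v hv w hw hvw
      rcases hw with hw | hw
      · obtain ⟨h1, h2⟩ := Finset.mem_sdiff.1 hw
        exact hun S hS w ⟨h2, v, hTΦ hv, hvw⟩ h1
      · exact hσΨ w hw (hbd w ⟨fun h => hσΨ w hw (hΦ h), v, hTΦ hv, hvw⟩)
    refine ⟨mem_admissible.2 ⟨Finset.union_subset (hTΦ.trans hΦ) (Finset.sdiff_subset.trans hSΨ),
      ?_⟩, Finset.card_union_of_disjoint ?_⟩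
    · intro v hv w hw hne hvw
      have key : ∀ v ∈ (↑(T ∪ S \ Φ) ∪ σ : Set V), v ∈ T ∨ (v ∈ S \ Φ ∨ v ∈ σ) := by
        intro v hv
        simpa [or_assoc] using hv
      have key2 : ∀ v, v ∈ S \ Φ ∨ v ∈ σ → v ∈ (↑S ∪ σ : Set V) := by
        rintro v (h | h)
        · exact .inl (Finset.mem_sdiff.1 h).1
        · exact .inr h
      rcases key v hv with hv | hv <;> rcases key w hw with hw | hw
      · exact hTind hv hw hne hvw
      · exact hno v hv w hw hvw
      · exact hno w hw v hv hvw.symm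
      · exact hSind (key2 v hv) (key2 w hw) hne hvw
    · exact Finset.disjoint_left.2 fun v hv hv' => (Finset.mem_sdiff.1 hv').2 (hTΦ hv)
  have hrestr : ∀ S ∈ maxConfigs G Ψ σ, S ∩ Φ ∈ maxConfigs G Φ ∅ := by
    intro S hS
    obtain ⟨hSa, hSmax⟩ := mem_maxConfigs.1 hS
    obtain ⟨hSΨ, hSind⟩ := mem_admissible.1 hSa
    refine mem_maxConfigs.2 ⟨mem_admissible.2 ⟨Finset.inter_subset_right, ?_⟩, fun T hT => ?_⟩
    · refine hSind.mono ?_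
      rw [Set.union_empty]
      exact fun v hv => .inl (Finset.mem_inter.1 hv).1
    · obtain ⟨h1, h2⟩ := swap S hS T hT
      have := hSmax _ h1
      have := Finset.card_inter_add_card_sdiff S Φ
      omega
  have hglue : ∀ S ∈ maxConfigs G Ψ σ, ∀ T ∈ maxConfigs G Φ ∅,
      T ∪ S \ Φ ∈ maxConfigs G Ψ σ := by
    intro S hS T hT
    obtain ⟨h1, h2⟩ := swap S hS T (mem_maxConfigs.1 hT).1
    refine mem_maxConfigs.2 ⟨h1, fun S' hS' => ?_⟩
    have := (mem_maxConfigs.1 hS).2 S' hS'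
    have := (mem_maxConfigs.1 hT).2 _ (mem_maxConfigs.1 (hrestr S hS)).1
    have := Finset.card_inter_add_card_sdiff S Φ
    omega
  -- Maximum configurations are exactly the pairs of a maximum configuration on `Φ` and an exterior
  -- part in `R`, so the factor `R.card` cancels in the marginal.
  set R := (maxConfigs G Ψ σ).image (· \ Φ) with hR
  have hcount : ∀ p : Finset V → Prop,
      ((maxConfigs G Ψ σ).filter fun S => p (S ∩ Φ)).card =
        ((maxConfigs G Φ ∅).filter p).card * R.card := by
    intro p
    rw [← Finset.card_product]
    refine Finset.card_nbij' (fun S => (S ∩ Φ, S \ Φ)) (fun q => q.1 ∪ q.2) ?_ ?_ ?_ ?_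
    · intro S hS
      obtain ⟨h1, h2⟩ := Finset.mem_filter.1 hS
      exact Finset.mem_product.2 ⟨Finset.mem_filter.2 ⟨hrestr S h1, h2⟩,
        Finset.mem_image_of_mem _ h1⟩
    · rintro ⟨T, Q⟩ hq
      obtain ⟨h1, h2⟩ := Finset.mem_product.1 hq
      obtain ⟨hT, hpT⟩ := Finset.mem_filter.1 h1
      obtain ⟨S, hS, rfl⟩ := Finset.mem_image.1 h2
      have hTΦ := (mem_admissible.1 (mem_maxConfigs.1 hT).1).1
      refine Finset.mem_filter.2 ⟨hglue S hS T hT, ?_⟩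
      have : (T ∪ S \ Φ) ∩ Φ = T := by
        ext v; have := @hTΦ v; simp; tauto
      simpa only [this] using hpT
    · intro S _
      ext v; simp; tauto
    · rintro ⟨T, Q⟩ hq
      obtain ⟨h1, h2⟩ := Finset.mem_product.1 hq
      obtain ⟨hT, hpT⟩ := Finset.mem_filter.1 h1
      obtain ⟨S, hS, rfl⟩ := Finset.mem_image.1 h2
      have hTΦ := (mem_admissible.1 (mem_maxConfigs.1 hT).1).1
      refine Prod.ext ?_ ?_
      · ext v; have := @hTΦ v; simp; tauto
      · ext v; have := @hTΦ v; simp; tauto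
  have h1 := hcount fun _ => True
  have h2 := hcount fun T => T ∩ Λ = A
  simp only [Finset.filter_true, Finset.inter_assoc, Finset.inter_eq_right.2 hΛ] at h1 h2
  have hRpos : (R.card : ℝ) ≠ 0 := by
    have : R.Nonempty := (maxConfigs_nonempty hσ.2).image _
    exact_mod_cast this.card_pos.ne'
  unfold marginal
  rw [h1, h2]
  push_cast
  rw [mul_div_mul_right _ _ hRpos]
  congr!

end Marginal

end HardCore

namespace HardCore

/-! ### Distances in the tree and large balls in patches -/

section Distance

variable {c : List ℕ → ℕ}

lemma exists_walk_root (v : Vertex c) :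
    ∃ p : (tree c).Walk (root c) v, p.length = v.1.length := by
  obtain ⟨l, hl⟩ := v
  induction l with
  | nil => exact ⟨.nil, rfl⟩
  | cons i l ih =>
    obtain ⟨p, hp⟩ := ih hl.2
    exact ⟨p.concat (tree_adj.2 (.inl ⟨i, rfl⟩)), by
      rw [SimpleGraph.Walk.length_concat, hp, List.length_cons]⟩

lemma length_le_of_walk {u v : Vertex c} (p : (tree c).Walk u v) :
    v.1.length ≤ u.1.length + p.length := by
  induction p with
  | nil => simp
  | cons h p ih =>
    rw [SimpleGraph.Walk.length_cons]
    rcases tree_adj.1 h with h | h <;> have := h.length <;> omega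

lemma le_edist {u v : Vertex c} {n : ℕ} (h : u.1.length + n ≤ v.1.length) :
    (n : ℕ∞) ≤ (tree c).edist u v := by
  refine le_iInf fun p => ?_
  have := length_le_of_walk p
  exact_mod_cast (by omega : n ≤ p.length)

/-- The walk from `u` through the root to `v` must leave `Ψ`, and it does so at a boundary vertex.
-/
lemma exists_mem_boundary_edist_le {Ψ : Finset (Vertex c)} {u v : Vertex c} (hu : u ∈ Ψ) (hv : v ∉ Ψ) :
    ∃ w ∈ boundary (tree c) Ψ, (tree c).edist u w ≤ (u.1.length + v.1.length : ℕ) := by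
  classical
  obtain ⟨p, hp⟩ := exists_walk_root u
  obtain ⟨q, hq⟩ := exists_walk_root v
  obtain ⟨e, he, h1, h2⟩ := (p.reverse.append q).exists_boundary_dart (↑Ψ) hu hv
  refine ⟨e.snd, ⟨h2, e.fst, h1, e.adj⟩, ?_⟩
  have hmem := SimpleGraph.Walk.dart_snd_mem_support_of_mem_darts _ he
  refine (SimpleGraph.Walk.edist_le ((p.reverse.append q).takeUntil _ hmem)).trans ?_
  have := (p.reverse.append q).length_takeUntil_le_length hmem
  rw [SimpleGraph.Walk.length_append, SimpleGraph.Walk.length_reverse, hp, hq] at this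
  exact_mod_cast this

lemma eventually_ball_subset {Λ : Finset (Vertex c)} (hΛ : Λ.Nonempty) {Ψ : ℕ → Finset (Vertex c)}
    (hΛΨ : ∀ n, Λ ⊆ Ψ n)
    (hdist : Filter.Tendsto (fun n => setDist (tree c) Λ (boundary (tree c) (Ψ n))) Filter.atTop
      (nhds ⊤)) (R : ℕ) :
    ∀ᶠ n in Filter.atTop, ∀ v : Vertex c, v.1.length ≤ R → v ∈ Ψ n := by
  obtain ⟨u, hu⟩ := hΛ
  filter_upwards [hdist.eventually (lt_mem_nhds (ENat.natCast_lt_top (u.1.length + R)))] with n hn v hv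
  by_contra hcon
  obtain ⟨w, hw, hle⟩ := exists_mem_boundary_edist_le (hΛΨ n hu) hcon
  have h1 : setDist (tree c) Λ (boundary (tree c) (Ψ n)) ≤ (tree c).edist u w :=
    (iInf₂_le u hu).trans (iInf₂_le w hw)
  have h2 := hn.trans_le (h1.trans hle)
  have h3 : u.1.length + R < u.1.length + v.1.length := by exact_mod_cast h2
  omega

end Distance

/-! ### Total variation and single-vertex marginals -/

section TotalVariation

variable {V : Type*} {G : SimpleGraph V} {Ψ : Finset V} {σ τ : Set V}

lemma tvDist_eq_zero {Λ : Finset V} (h : ∀ A, marginal G Ψ σ Λ A = marginal G Ψ τ Λ A) :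
    tvDist G Ψ σ τ Λ = 0 := by
  simp [tvDist, h]

lemma marginal_empty (hσ : G.IsIndepSet σ) {A : Finset V} (hA : A = ∅) :
    marginal G Ψ σ ∅ A = 1 := by
  have : ((maxConfigs G Ψ σ).card : ℝ) ≠ 0 := by
    exact_mod_cast (maxConfigs_nonempty hσ).card_pos.ne'
  subst hA
  simp [marginal, this]

lemma marginal_singleton (v : V) [DecidablePred fun S : Finset V => v ∈ S] : marginal G Ψ σ {v} {v} =
    (((maxConfigs G Ψ σ).filter fun S => v ∈ S).card : ℝ) / ((maxConfigs G Ψ σ).card : ℝ) := by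
  unfold marginal
  congr!
  simp

lemma marginal_singleton_of_mem (hσ : G.IsIndepSet σ) {v : V}
    (h : ∀ S ∈ maxConfigs G Ψ σ, v ∈ S) : marginal G Ψ σ {v} {v} = 1 := by
  classical
  have : ((maxConfigs G Ψ σ).card : ℝ) ≠ 0 := by
    exact_mod_cast (maxConfigs_nonempty hσ).card_pos.ne'
  rw [marginal_singleton, Finset.filter_true_of_mem h, div_self this]

lemma marginal_singleton_of_notMem {v : V}
    (h : ∀ S ∈ maxConfigs G Ψ σ, v ∉ S) : marginal G Ψ σ {v} {v} = 0 := by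
  classical
  rw [marginal_singleton, Finset.filter_false_of_mem h]
  simp

lemma le_tvDist_singleton (v : V) :
    1 / 2 * |marginal G Ψ σ {v} {v} - marginal G Ψ τ {v} {v}| ≤ tvDist G Ψ σ τ {v} := by
  unfold tvDist
  gcongr
  exact Finset.single_le_sum (f := fun A => |marginal G Ψ σ {v} A - marginal G Ψ τ {v} A|)
    (fun _ _ => abs_nonneg _) (by simp)

end TotalVariation

/-! ### Weak spatial mixing: proof from finite clusters, failure from draws -/

section Weak

variable (c : List ℕ → ℕ)

/-- The vertices all of whose ancestors (themselves included) beyond level `L` do not have two lost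
children. -/
def InCluster (L : ℕ) : List ℕ → Prop
  | [] => True
  | i :: l => InCluster L l ∧ (l.length < L ∨ shift (i :: l) c ∉ twoChildren lose)

variable {c}

lemma InCluster.of_append {L : ℕ} {m l : List ℕ} (h : InCluster c L (m ++ l)) :
    InCluster c L l := by
  induction m with
  | nil => exact h
  | cons i m ih => exact ih h.1

lemma InCluster.notMem {L : ℕ} {l : List ℕ} (h : InCluster c L l) (hl : L < l.length) :
    shift l c ∉ twoChildren lose := by
  cases l with
  | nil => simp at hl
  | cons i l => exact h.2.resolve_left (by rw [List.length_cons] at hl; omega)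

lemma InCluster.of_length_le {L : ℕ} {l : List ℕ} (h : l.length ≤ L) : InCluster c L l := by
  induction l with
  | nil => trivial
  | cons i l ih =>
    rw [List.length_cons] at h
    exact ⟨ih (by omega), .inl (by omega)⟩

lemma InCluster.reach {L : ℕ} {m l : List ℕ} (h : InCluster c L (m ++ l)) (hl : L < l.length)
    (ht : InTree c (m ++ l)) : shift l c ∈ reach m.length := by
  induction m using List.reverseRecOn generalizing l with
  | nil => exact h.notMem hl
  | append_singleton m i ih =>
    rw [List.append_assoc] at h ht
    have h1 := ih (l := [i] ++ l) h (by simp; omega) ht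
    rw [List.length_append, List.length_singleton]
    refine ⟨h.of_append.of_append.notMem hl, i, (inTree_of_append c ht).1, ?_⟩
    rw [shift_shift]
    exact h1

/-- Level `L + 1` is finite, and a long cluster path would cross it at some `k` and put `shift k c`
in `reach n` for a forbidden `n`. -/
lemma exists_inCluster_length_le (h : ∀ l, ∃ n, shift l c ∉ reach n) (L : ℕ) :
    ∃ K, ∀ l, InTree c l → InCluster c L l → l.length ≤ K := by
  choose f hf using h
  obtain ⟨N, hN⟩ := ((finite_level c (L + 1)).image f).bddAbove
  refine ⟨L + 1 + N, fun l hl hc => ?_⟩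
  by_contra! hlt
  obtain ⟨m, k, rfl, hk⟩ : ∃ m k, l = m ++ k ∧ k.length = L + 1 :=
    ⟨l.take (l.length - (L + 1)), l.drop (l.length - (L + 1)), (List.take_append_drop _ _).symm, by
      rw [List.length_drop]; omega⟩
  rw [List.length_append] at hlt
  have hkT := inTree_of_append c hl
  have h1 : f k ≤ N := hN ⟨k, ⟨hkT, hk⟩, rfl⟩
  exact hf k (reach_anti (by omega) (hc.reach (by omega) hl))

lemma exists_twoChildren_losesIn (K : ℕ) : ∃ M, ∀ v : Vertex c, v.1.length ≤ K →
    shift v.1 c ∈ twoChildren lose → shift v.1 c ∈ twoChildren (losesIn M) := by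
  have h : ∀ v : Vertex c, ∃ n, shift v.1 c ∈ twoChildren lose →
      shift v.1 c ∈ twoChildren (losesIn n) := by
    intro v
    by_cases hv : shift v.1 c ∈ twoChildren lose
    · obtain ⟨i, hi, j, hj, hij, h1, h2⟩ := hv
      obtain ⟨n, hn⟩ := Set.mem_iUnion.1 h1
      obtain ⟨m, hm⟩ := Set.mem_iUnion.1 h2
      exact ⟨max n m, fun _ => ⟨i, hi, j, hj, hij, losesIn_mono (le_max_left _ _) hn,
        losesIn_mono (le_max_right _ _) hm⟩⟩
    · exact ⟨0, fun h => absurd h hv⟩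
  choose f hf using h
  obtain ⟨M, hM⟩ := ((finite_ball c K).image f).bddAbove
  refine ⟨M, fun v hv h => ?_⟩
  obtain ⟨i, hi, j, hj, hij, h1, h2⟩ := hf v h
  have hle : f v ≤ M := hM ⟨v, hv, rfl⟩
  exact ⟨i, hi, j, hj, hij, losesIn_mono hle h1, losesIn_mono hle h2⟩

/-- Positions lost within few rounds are lost relative to every patch that contains a large
ball. -/
lemma isLosing_losesIn {Ψ : Finset (Vertex c)} {σ : Set (Vertex c)} {R : ℕ}
    (hΨ : ∀ v : Vertex c, v.1.length ≤ R → v ∈ Ψ) (hσ : ∀ v ∈ σ, v ∉ Ψ) :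
    IsLosing Ψ σ {v | ∃ n, shift v.1 c ∈ losesIn n ∧ v.1.length + 2 * n ≤ R} := by
  rintro v ⟨n, hn, hle⟩
  -- No position is lost within 0 rounds. A round descends two levels, so a grandchild lost within
  -- `n` rounds again satisfies the bound by `R`.
  cases n with
  | zero => exact hn.elim
  | succ n =>
    refine ⟨hΨ v (by omega), fun w hvw => ?_⟩
    have hw := hvw.length
    refine ⟨fun h => hσ w h (hΨ w (by omega)), fun _ => ?_⟩
    obtain ⟨i, hi⟩ := hvw
    have hwt := w.2
    rw [hi] at hwt
    obtain ⟨j, hj, hjn⟩ := hn i hwt.1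
    rw [shift_shift] at hj hjn
    rw [shift_shift] at hjn
    have hwl : [i] ++ v.1 = w.1 := hi.symm
    rw [shift_apply_nil, hwl] at hj
    rw [List.append_assoc, hwl] at hjn
    refine ⟨⟨j :: w.1, hj, w.2⟩, ⟨j, rfl⟩, .inl ⟨n, hjn, ?_⟩⟩
    simp only [List.length_cons]
    omega

/-- Weak spatial mixing holds if the clusters of vertices without two lost children are finite. -/
lemma wsm_of_reach (h : ∀ l, ∃ n, shift l c ∉ reach n) : WSM (tree c) := by
  intro Λ Ψ σ τ hΛ hσ hτ hdist
  -- For empty `Λ` the distance is always `⊤` and says nothing about the patch, but the marginal is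
  -- trivial.
  rcases Λ.eq_empty_or_nonempty with rfl | hne
  · have : ∀ n, tvDist (tree c) (Ψ n) (σ n) (τ n) ∅ = 0 := by
      intro n
      simp [tvDist, marginal_empty (hσ n).2, marginal_empty (hτ n).2]
    simp only [this]
    exact tendsto_const_nhds
  set L := Λ.sup fun v => v.1.length
  obtain ⟨K, hK⟩ := exists_inCluster_length_le h L
  obtain ⟨M, hM⟩ := exists_twoChildren_losesIn (c := c) (K + 1)
  have hfin : {v : Vertex c | InCluster c L v.1}.Finite :=
    (finite_ball c K).subset fun v hv => hK v.1 v.2 hv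
  set Φ := hfin.toFinset with hΦdef
  have hΦ : ∀ v, v ∈ Φ ↔ InCluster c L v.1 := fun v => by simp [hΦdef]
  have hΦK : ∀ v ∈ Φ, v.1.length ≤ K := fun v hv => hK v.1 v.2 ((hΦ v).1 hv)
  have hΛΦ : Λ ⊆ Φ := fun v hv => (hΦ v).2 (.of_length_le (Finset.le_sup (f := fun v : Vertex c => v.1.length) hv))
  have hbd : ∀ w ∈ boundary (tree c) Φ, w.1.length ≤ K + 1 ∧ shift w.1 c ∈ twoChildren lose := by
    rintro w ⟨hw, v, hv, hadj⟩
    rw [hΦ] at hw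
    have hvΦ := (hΦ v).1 hv
    rcases tree_adj.1 hadj with hvw | hwv
    · refine ⟨by rw [hvw.length]; have := hΦK v hv; omega, ?_⟩
      obtain ⟨i, hi⟩ := hvw
      by_contra hcon
      rw [hi] at hw hcon
      exact hw ⟨hvΦ, .inr hcon⟩
    · obtain ⟨i, hi⟩ := hwv
      rw [hi] at hvΦ
      exact absurd hvΦ.1 hw
  have key : ∀ᶠ n in Filter.atTop, tvDist (tree c) (Ψ n) (σ n) (τ n) Λ = 0 := by
    -- Boundary vertices of `Φ` lie at level at most `K + 1`, their lost children at most at `K +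
    -- 2`, and `M` rounds of the game use `2 * M` further levels.
    filter_upwards [eventually_ball_subset hne hΛ hdist (K + 2 + 2 * M)] with n hn
    have hmarg : ∀ ρ, IsBoundaryCondition (tree c) (Ψ n) ρ → ∀ A,
        marginal (tree c) (Ψ n) ρ Λ A = marginal (tree c) Φ ∅ Λ A := by
      intro ρ hρ A
      refine marginal_eq_of_boundary_unoccupied hΛΦ (fun v hv => hn v ?_) (fun v hv => hn v ?_)
        hρ ?_ A
      · have := hΦK v hv; omega
      · have := (hbd v hv).1; omega
      · intro S hS w hw
        obtain ⟨hwK, hw2⟩ := hbd w hw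
        obtain ⟨i, hi, j, hj, hij, h1, h2⟩ := hM w hwK hw2
        have hρΨ : ∀ v ∈ ρ, v ∉ Ψ n := fun v hv => (hρ.1 hv).1
        rw [shift_shift] at h1 h2
        refine notMem_of_isLosing (isLosing_losesIn hn hρΨ) hS (u := w)
          (x := ⟨i :: w.1, hi, w.2⟩) (y := ⟨j :: w.1, hj, w.2⟩)
          (fun hwρ => hρΨ w hwρ (hn w (by omega))) ⟨i, rfl⟩ ⟨j, rfl⟩ ?_ ⟨M, h1, ?_⟩ ⟨M, h2, ?_⟩
        · intro he
          exact hij (List.cons.inj (congrArg Subtype.val he)).1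
        · simp only [List.length_cons]; omega
        · simp only [List.length_cons]; omega
    exact tvDist_eq_zero fun A => (hmarg _ (hσ n) A).trans (hmarg _ (hτ n) A).symm
  exact tendsto_const_nhds.congr' (key.mono fun n hn => hn.symm)

lemma exists_child_notMem_win {v : Vertex c} (h : shift v.1 c ∉ lose) :
    ∃ x, IsChild v x ∧ shift x.1 c ∉ win := by
  rw [lose_eq] at h
  have h : ∃ i, i < shift v.1 c [] ∧ shift [i] (shift v.1 c) ∉ win := by
    simpa [allChildren] using h
  obtain ⟨i, hi, hw⟩ := h
  rw [shift_shift] at hw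
  exact ⟨⟨i :: v.1, hi, v.2⟩, ⟨i, rfl⟩, hw⟩

lemma notMem_lose_of_isChild {v w : Vertex c} (h : shift v.1 c ∉ win) (hvw : IsChild v w) :
    shift w.1 c ∉ lose := by
  intro hw
  obtain ⟨i, hi⟩ := hvw
  have hwt := w.2
  rw [hi] at hw hwt
  exact h ⟨i, hwt.1, by rw [shift_shift]; exact hw⟩

/-- Weak spatial mixing fails at the root if the root has two children, both drawn: the spin of the
root is then determined by the boundary condition on a sphere. -/
lemma not_wsmAt_root (h2 : c [] = 2) (hdraw : ∀ i < 2, shift [i] c ∈ draw) :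
    ¬ WSMAt (tree c) {root c} := by
  intro hW
  set Ψ : ℕ → Finset (Vertex c) := fun k => (finite_ball c (2 * k + 1)).toFinset with hΨdef
  have hΨ : ∀ k v, v ∈ Ψ k ↔ v.1.length ≤ 2 * k + 1 := fun k v => by simp [hΨdef]
  set τ : ℕ → Set (Vertex c) := fun k => {v | v.1.length = 2 * k + 2} with hτdef
  have hbd : ∀ k, ∀ w ∈ boundary (tree c) (Ψ k), w.1.length = 2 * k + 2 := by
    rintro k w ⟨hw, v, hv, hadj⟩
    rw [hΨ] at hw hv
    rcases tree_adj.1 hadj with h | h <;> have := h.length <;> omega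
  have hτ : ∀ k, IsBoundaryCondition (tree c) (Ψ k) (τ k) := by
    refine fun k => ⟨fun w hw => ?_, isIndepSet_tree_iff.2 fun v hv w hw h => ?_⟩
    · have hw : w.1.length = 2 * k + 2 := hw
      obtain ⟨_ | ⟨i, l⟩, hl⟩ := w
      · simp at hw
      · simp only [List.length_cons] at hw
        refine ⟨fun h => ?_, ⟨l, hl.2⟩, (hΨ _ _).2 (by simp only; omega), .inl ⟨i, rfl⟩⟩
        rw [hΨ] at h
        simp only [List.length_cons] at h
        omega
    · have := h.length
      have hv : v.1.length = 2 * k + 2 := hv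
      have hw : w.1.length = 2 * k + 2 := hw
      omega
  have hwin : shift (root c).1 c ∉ win := by
    rintro ⟨i, hi, hl⟩
    rw [shift_shift] at hl
    exact hdraw i (by rw [← h2]; exact hi) (.inl hl)
  -- The sphere at level `2 * k + 2` is occupied, so every non-won position at an even level acts as
  -- lost, in particular the root, which has no parent.
  have hocc : ∀ k, marginal (tree c) (Ψ k) (τ k) {root c} {root c} = 1 := by
    intro k
    refine marginal_singleton_of_mem (hτ k).2 fun S hS => ?_
    have hL : IsLosing (Ψ k) (τ k)
        {v | v.1.length ≤ 2 * k + 1 ∧ Even v.1.length ∧ shift v.1 c ∉ win} := by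
      rintro v ⟨h1, ⟨m, hm⟩, h3⟩
      refine ⟨(hΨ k v).2 h1, fun w hvw => ⟨fun hw => ?_, fun _ => ?_⟩⟩
      · have hw : w.1.length = 2 * k + 2 := hw
        have := hvw.length
        omega
      · obtain ⟨x, hwx, hx⟩ := exists_child_notMem_win (notMem_lose_of_isChild h3 hvw)
        have e1 := hvw.length
        have e2 := hwx.length
        refine ⟨x, hwx, ?_⟩
        by_cases hxk : x.1.length ≤ 2 * k + 1
        · exact .inl ⟨hxk, ⟨m + 1, by omega⟩, hx⟩
        · exact .inr (show x.1.length = 2 * k + 2 by omega)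
    refine mem_of_isLosing hL hS ⟨by simp [root], by simp [root], hwin⟩ fun u hu => ?_
    have := hu.length
    simp [root] at this
  -- With the sphere unoccupied, non-won positions at odd levels act as lost, in particular both
  -- children of the root.
  have hunocc : ∀ k, marginal (tree c) (Ψ k) ∅ {root c} {root c} = 0 := by
    intro k
    refine marginal_singleton_of_notMem fun S hS => ?_
    have hL : IsLosing (Ψ k) ∅
        {v | v.1.length ≤ 2 * k + 1 ∧ Odd v.1.length ∧ shift v.1 c ∉ win} := by
      rintro v ⟨h1, ⟨m, hm⟩, h3⟩
      refine ⟨(hΨ k v).2 h1, fun w hvw => ⟨fun hw => hw.elim, fun hw => ?_⟩⟩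
      rw [hΨ] at hw
      obtain ⟨x, hwx, hx⟩ := exists_child_notMem_win (notMem_lose_of_isChild h3 hvw)
      have e1 := hvw.length
      have e2 := hwx.length
      exact ⟨x, hwx, .inl ⟨by omega, ⟨m + 1, by omega⟩, hx⟩⟩
    refine notMem_of_isLosing hL hS (u := root c)
      (x := ⟨[0], by rw [h2]; norm_num, trivial⟩) (y := ⟨[1], by rw [h2]; norm_num, trivial⟩)
      (fun h => h.elim) ⟨0, rfl⟩ ⟨1, rfl⟩ (fun h => by simpa using congrArg Subtype.val h) ⟨by simp, by simp, fun h => ?_⟩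
      ⟨by simp, by simp, fun h => ?_⟩
    · exact hdraw 0 (by norm_num) (.inr h)
    · exact hdraw 1 (by norm_num) (.inr h)
  have hlim := hW Ψ (fun _ => ∅) τ
    (fun k => by simp [hΨ, root])
    (fun k => ⟨Set.empty_subset _, by simp⟩) hτ ?_
  · have hge : ∀ k, (1 / 2 : ℝ) ≤ tvDist (tree c) (Ψ k) ∅ (τ k) {root c} := by
      intro k
      have := le_tvDist_singleton (G := tree c) (Ψ := Ψ k) (σ := ∅) (τ := τ k) (root c)
      rw [hocc, hunocc] at this
      norm_num at this
      linarith
    have := ge_of_tendsto' hlim hge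
    norm_num at this
  · refine tendsto_of_tendsto_of_tendsto_of_le_of_le ENat.tendsto_natCast_nhds_top tendsto_const_nhds
      (fun k => ?_) (fun k => le_top)
    refine le_iInf₂ fun u hu => le_iInf₂ fun w hw => le_edist ?_
    rw [Finset.mem_singleton.1 hu, hbd k w hw]
    simp [root]
    omega

end Weak

end HardCore

namespace HardCore

/-! ### Failure of strong spatial mixing on two-sided infinite paths -/

section Strong

variable {c : List ℕ → ℕ}

lemma exists_survive_child {v : Vertex c} (h : shift v.1 c ∈ survive) :
    ∃ w, IsChild v w ∧ shift w.1 c ∈ survive := by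
  rw [survive_eq] at h
  obtain ⟨i, hi, hs⟩ := h
  rw [shift_shift] at hs
  exact ⟨⟨i :: v.1, hi, v.2⟩, ⟨i, rfl⟩, hs⟩

lemma exists_ray {v : Vertex c} (h : shift v.1 c ∈ survive) :
    ∃ a : ℕ → Vertex c, a 0 = v ∧ ∀ n, IsChild (a n) (a (n + 1)) := by
  choose! f hf hfs using fun (v : Vertex c) (h : shift v.1 c ∈ survive) => exists_survive_child h
  have hs : ∀ n, shift (f^[n] v).1 c ∈ survive := by
    intro n
    induction n with
    | zero => exact h
    | succ n ih => rw [Function.iterate_succ_apply']; exact hfs _ ih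
  exact ⟨fun n => f^[n] v, rfl, fun n => by
    simp only [Function.iterate_succ_apply']; exact hf _ (hs n)⟩

/-- A vertex with two infinite child subtrees is the highest vertex of a two-sided infinite path. -/
lemma exists_two_sided_path {v : Vertex c} (h : shift v.1 c ∈ twoChildren survive) :
    ∃ ψ : ℤ → Vertex c, Function.Injective ψ ∧ ψ 0 = v ∧ (∀ z, (ψ z).1.length = v.1.length + z.natAbs) ∧
      (∀ z, 0 ≤ z → IsChild (ψ z) (ψ (z + 1))) ∧ ∀ z, z ≤ 0 → IsChild (ψ z) (ψ (z - 1)) := by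
  obtain ⟨i, hi, j, hj, hij, hsi, hsj⟩ := h
  rw [shift_shift] at hsi hsj
  obtain ⟨a, ha0, ha⟩ := exists_ray (v := ⟨i :: v.1, hi, v.2⟩) hsi
  obtain ⟨b, hb0, hb⟩ := exists_ray (v := ⟨j :: v.1, hj, v.2⟩) hsj
  have hal : ∀ n, (a n).1.length = v.1.length + 1 + n := by
    intro n
    induction n with
    | zero => rw [ha0]; rfl
    | succ n ih => rw [(ha n).length, ih]; rfl
  have hbl : ∀ n, (b n).1.length = v.1.length + 1 + n := by
    intro n
    induction n with
    | zero => rw [hb0]; rfl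
    | succ n ih => rw [(hb n).length, ih]; rfl
  have hab : ∀ n, a n ≠ b n := by
    intro n
    induction n with
    | zero =>
      rw [ha0, hb0]
      exact fun h => hij (List.cons.inj (congrArg Subtype.val h)).1
    | succ n ih =>
      intro h
      have h1 := ha n
      rw [h] at h1
      exact ih (h1.parent_unique (hb n))
  let ψ : ℤ → Vertex c
    | .ofNat 0 => v
    | .ofNat (n + 1) => a n
    | .negSucc n => b n
  have hψl : ∀ z, (ψ z).1.length = v.1.length + z.natAbs := by
    rintro ((_ | n) | n)
    · rfl
    · exact (hal n).trans (by simp; omega)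
    · exact (hbl n).trans (by simp; omega)
  refine ⟨ψ, fun y z hyz => ?_, rfl, hψl, ?_, ?_⟩
  · have hl := hψl y
    rw [hyz, hψl z] at hl
    have hne : ∀ n : ℕ, ψ ((n + 1 : ℕ) : ℤ) ≠ ψ (-((n + 1 : ℕ) : ℤ)) := fun n => hab n
    by_contra hcon
    obtain ⟨n, hn⟩ : ∃ n, y.natAbs = n + 1 := ⟨y.natAbs - 1, by omega⟩
    rcases le_total 0 y with hy | hy
    · obtain rfl : y = ((n + 1 : ℕ) : ℤ) := by omega
      obtain rfl : z = -((n + 1 : ℕ) : ℤ) := by omega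
      exact hne n hyz
    · obtain rfl : z = ((n + 1 : ℕ) : ℤ) := by omega
      obtain rfl : y = -((n + 1 : ℕ) : ℤ) := by omega
      exact hne n hyz.symm
  · rintro ((_ | n) | n) hz
    · change IsChild v (a 0)
      rw [ha0]; exact ⟨i, rfl⟩
    · exact ha n
    · omega
  · rintro ((_ | n) | n) hz
    · change IsChild v (b 0)
      rw [hb0]; exact ⟨j, rfl⟩
    · simp at hz; omega
    · exact hb n

/-- Strong spatial mixing fails at the centre of a two-sided infinite path. In the finite pieces of
the path with an odd number of vertices there is just one maximum configuration; removing one end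
point makes the two central vertices exchangeable. -/
lemma not_ssmAt_of_twoChildren {v : Vertex c} (h : shift v.1 c ∈ twoChildren survive) :
    ¬ SSMAt (tree c) {v} := by
  classical
  obtain ⟨ψ, hinj, hψ0, hlen, hup, hdown⟩ := exists_two_sided_path h
  have hchild : ∀ y z, IsChild (ψ y) (ψ z) → (0 ≤ y ∧ z = y + 1) ∨ (y ≤ 0 ∧ z = y - 1) := by
    intro y z hyz
    have hl := hyz.length
    rw [hlen, hlen] at hl
    rcases le_total 0 z with hz | hz
    · have h1 := hup (z - 1) (by omega)
      rw [sub_add_cancel] at h1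
      have := hinj (hyz.parent_unique h1)
      omega
    · have h1 := hdown (z + 1) (by omega)
      rw [add_sub_cancel_right] at h1
      have := hinj (hyz.parent_unique h1)
      omega
  have hadj : ∀ y z, (tree c).Adj (ψ y) (ψ z) ↔ z = y + 1 ∨ z = y - 1 := by
    intro y z
    constructor
    · intro h
      rcases tree_adj.1 h with h | h <;> rcases hchild _ _ h with h | h <;> omega
    · intro h
      rcases le_total 0 y with hy | hy <;> rcases le_total 0 z with hz | hz <;>
        rcases h with rfl | rfl
      · exact .inl (hup y hy)
      · have := hup (y - 1) hz
        rw [sub_add_cancel] at this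
        exact .inr this
      · exact absurd hz (by omega)
      · obtain rfl | rfl : y = 0 ∨ y = 1 := by omega
        · exact .inl (hdown 0 le_rfl)
        · exact .inr (hup 0 le_rfl)
      · obtain rfl | rfl : y = 0 ∨ y = -1 := by omega
        · exact .inl (hup 0 le_rfl)
        · exact .inr (hdown 0 le_rfl)
      · exact .inl (hdown y hy)
      · have := hdown (y + 1) hz
        rw [add_sub_cancel_right] at this
        exact .inr this
      · exact .inl (hdown y hy)
  intro hS
  -- The patch is the bare path: all vertices hanging off it are frozen unoccupied under both
  -- conditions, which strong mixing allows although they may be close to `v`.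
  set Ψ : ℕ → Finset (Vertex c) := fun n => (Finset.Icc (-(2 * n : ℤ)) (2 * n)).image ψ with hΨdef
  have hΨ : ∀ n z, ψ z ∈ Ψ n ↔ -(2 * n : ℤ) ≤ z ∧ z ≤ 2 * n := by
    intro n z
    simp only [hΨdef, Finset.mem_image, Finset.mem_Icc]
    exact ⟨fun ⟨y, hy, he⟩ => hinj he ▸ hy, fun h => ⟨z, h, rfl⟩⟩
  have hΨ' : ∀ n u, u ∈ Ψ n → ∃ z, u = ψ z ∧ -(2 * n : ℤ) ≤ z ∧ z ≤ 2 * n := by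
    intro n u hu
    simp only [hΨdef, Finset.mem_image, Finset.mem_Icc] at hu
    obtain ⟨z, hz, rfl⟩ := hu
    exact ⟨z, rfl, hz⟩
  -- Occupying this vertex excludes `ψ (2 * n)`, leaving an even path of `4 * n` vertices, symmetric
  -- under `z ↦ -1 - z`.
  set τ : ℕ → Set (Vertex c) := fun n => {ψ (2 * n + 1)} with hτdef
  have hτ : ∀ n, IsBoundaryCondition (tree c) (Ψ n) (τ n) := by
    intro n
    refine ⟨?_, by simp [hτdef]⟩
    rintro _ rfl
    refine ⟨fun h => ?_, ψ (2 * n), (hΨ n _).2 ⟨by omega, le_rfl⟩, (hadj _ _).2 (.inl rfl)⟩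
    have := ((hΨ n _).1 h).2
    omega
  have hfree : ∀ n, marginal (tree c) (Ψ n) ∅ {v} {v} = 1 := by
    intro n
    refine marginal_singleton_of_mem (by simp) fun S hS => ?_
    have hL : IsLosing (Ψ n) ∅ {u | ∃ z : ℤ, u = ψ z ∧ Even z ∧ -(2 * n : ℤ) ≤ z ∧ z ≤ 2 * n} := by
      rintro _ ⟨z, rfl, ⟨m, hm⟩, h1, h2⟩
      refine ⟨(hΨ n z).2 ⟨h1, h2⟩, fun w hw => ⟨fun h => h.elim, fun hwΨ => ?_⟩⟩
      obtain ⟨y, rfl, h3, h4⟩ := hΨ' n w hwΨ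
      rcases hchild z y hw with ⟨hz, rfl⟩ | ⟨hz, rfl⟩
      · exact ⟨ψ (z + 1 + 1), hup _ (by omega), .inl ⟨_, rfl, ⟨m + 1, by omega⟩, by omega, by omega⟩⟩
      · exact ⟨ψ (z - 1 - 1), hdown _ (by omega), .inl ⟨_, rfl, ⟨m - 1, by omega⟩, by omega, by omega⟩⟩
    refine mem_of_isLosing hL hS ⟨0, hψ0.symm, ⟨0, rfl⟩, by omega, by omega⟩ fun u hu => ⟨?_, fun h => h⟩
    intro huS
    obtain ⟨z, rfl, -⟩ := hΨ' n u ((mem_admissible.1 (mem_maxConfigs.1 hS).1).1 huS)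
    have := hu.length
    rw [hlen] at this
    omega
  have hhalf : ∀ n : ℕ, marginal (tree c) (Ψ n) (τ n) {v} {v} ≤ 1 / 2 := by
    intro n
    set I := Finset.Icc (-(2 * n : ℤ)) (2 * n - 1) with hI
    -- reflection of the configurations on the path without its end point
    set T : Finset (Vertex c) → Finset (Vertex c) :=
      fun S => (I.filter fun z => ψ (-1 - z) ∈ S).image ψ with hTdef
    have memT : ∀ S z, ψ z ∈ T S ↔ z ∈ I ∧ ψ (-1 - z) ∈ S := by
      intro S z
      simp only [hTdef, Finset.mem_image, Finset.mem_filter]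
      exact ⟨fun ⟨y, hy, he⟩ => hinj he ▸ hy, fun h => ⟨z, h, rfl⟩⟩
    have memT' : ∀ S u, u ∈ T S → ∃ z, u = ψ z ∧ z ∈ I ∧ ψ (-1 - z) ∈ S := by
      intro S u hu
      simp only [hTdef, Finset.mem_image, Finset.mem_filter] at hu
      obtain ⟨z, hz, rfl⟩ := hu
      exact ⟨z, rfl, hz⟩
    have hsub : ∀ S ∈ admissible (tree c) (Ψ n) (τ n), ∀ u ∈ S, ∃ z ∈ I, u = ψ z := by
      intro S hS u hu
      obtain ⟨hSΨ, hind⟩ := mem_admissible.1 hS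
      obtain ⟨z, rfl, h1, h2⟩ := hΨ' n u (hSΨ hu)
      refine ⟨z, Finset.mem_Icc.2 ⟨h1, ?_⟩, rfl⟩
      by_contra hcon
      obtain rfl : z = 2 * n := by omega
      have ha : (tree c).Adj (ψ (2 * n)) (ψ (2 * n + 1)) := (hadj _ _).2 (.inl rfl)
      exact hind (.inl hu) (.inr rfl) ha.ne ha
    have hTT : ∀ S ∈ admissible (tree c) (Ψ n) (τ n), T (T S) = S := by
      intro S hS
      ext u
      constructor
      · intro hu
        obtain ⟨z, rfl, -, h2⟩ := memT' _ _ hu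
        have := ((memT _ _).1 h2).2
        rwa [sub_sub_cancel] at this
      · intro hu
        obtain ⟨z, hz, rfl⟩ := hsub S hS u hu
        refine (memT _ _).2 ⟨hz, (memT _ _).2 ⟨?_, by rwa [sub_sub_cancel]⟩⟩
        rw [hI, Finset.mem_Icc] at hz ⊢
        omega
    have hTadm : ∀ S ∈ admissible (tree c) (Ψ n) (τ n), T S ∈ admissible (tree c) (Ψ n) (τ n) := by
      intro S hS
      obtain ⟨hSΨ, hind⟩ := mem_admissible.1 hS
      refine mem_admissible.2 ⟨fun u hu => ?_, ?_⟩
      · obtain ⟨z, rfl, hz, -⟩ := memT' _ _ hu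
        rw [hI, Finset.mem_Icc] at hz
        exact (hΨ n z).2 (by omega)
      · have hno : ∀ y z, ψ y ∈ T S → ψ z ∈ T S → ¬ (tree c).Adj (ψ y) (ψ z) := by
          intro y z hy hz ha
          have ha' : (tree c).Adj (ψ (-1 - y)) (ψ (-1 - z)) := by
            rw [hadj] at ha ⊢
            omega
          exact hind (.inl ((memT _ _).1 hy).2) (.inl ((memT _ _).1 hz).2) ha'.ne ha'
        have hno' : ∀ y, ψ y ∈ T S → ¬ (tree c).Adj (ψ y) (ψ (2 * n + 1)) := by
          intro y hy ha
          have := ((memT _ _).1 hy).1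
          rw [hI, Finset.mem_Icc] at this
          rw [hadj] at ha
          omega
        rintro x (hx | rfl) y (hy | rfl) hne ha
        · obtain ⟨p, rfl, -⟩ := memT' _ _ hx
          obtain ⟨q, rfl, -⟩ := memT' _ _ hy
          exact hno p q hx hy ha
        · obtain ⟨p, rfl, -⟩ := memT' _ _ hx
          exact hno' p hx ha
        · obtain ⟨q, rfl, -⟩ := memT' _ _ hy
          exact hno' q hy ha.symm
        · exact hne rfl
    have hTle : ∀ S, (T S).card ≤ S.card := by
      intro S
      refine Finset.card_image_le.trans ?_
      refine Finset.card_le_card_of_injOn (fun z => ψ (-1 - z))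
        (fun z hz => (Finset.mem_filter.1 hz).2) fun y _ z _ hyz => ?_
      have := hinj hyz
      omega
    have hTmax : ∀ S ∈ maxConfigs (tree c) (Ψ n) (τ n), T S ∈ maxConfigs (tree c) (Ψ n) (τ n) := by
      intro S hS
      obtain ⟨hSa, hmax⟩ := mem_maxConfigs.1 hS
      refine mem_maxConfigs.2 ⟨hTadm S hSa, fun S' hS' => (hmax S' hS').trans ?_⟩
      have := hTle (T S)
      rwa [hTT S hSa] at this
    set M := maxConfigs (tree c) (Ψ n) (τ n) with hM
    -- Reflection exchanges the adjacent positions 0 and -1, which are never both occupied, so it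
    -- injects configurations containing `v` into those avoiding it.
    have hle : (M.filter fun S => v ∈ S).card ≤ (M.filter fun S => v ∉ S).card := by
      refine Finset.card_le_card_of_injOn T (fun S hS => ?_) fun S hS S' hS' he => ?_
      · obtain ⟨hS, hv⟩ := Finset.mem_filter.1 hS
        refine Finset.mem_filter.2 ⟨hTmax S hS, fun hvT => ?_⟩
        rw [← hψ0] at hv hvT
        have h1 := ((memT _ _).1 hvT).2
        have ha : (tree c).Adj (ψ 0) (ψ (-1 - 0)) := (hadj _ _).2 (.inr rfl)
        exact (mem_admissible.1 (mem_maxConfigs.1 hS).1).2 (.inl hv) (.inl h1) ha.ne ha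
      · have h1 := hTT S (mem_maxConfigs.1 (Finset.mem_filter.1 hS).1).1
        have h2 := hTT S' (mem_maxConfigs.1 (Finset.mem_filter.1 hS').1).1
        rw [← h1, ← h2, he]
    have hsum := Finset.card_filter_add_card_filter_not (s := M) (fun S => v ∈ S)
    have hpos : (0 : ℝ) < M.card := by
      exact_mod_cast (maxConfigs_nonempty (hτ n).2).card_pos
    rw [marginal_singleton, ← hM, div_le_iff₀ hpos]
    have h2 : 2 * (M.filter fun S => v ∈ S).card ≤ M.card := by omega
    have h3 : (2 : ℝ) * (M.filter fun S => v ∈ S).card ≤ M.card := by exact_mod_cast h2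
    linarith
  have hlim := hS Ψ (fun _ => ∅) τ
    (fun n => by
      rw [Finset.singleton_subset_iff, ← hψ0, hΨ]
      omega)
    (fun n => ⟨Set.empty_subset _, by simp⟩) hτ ?_
  · have hge : ∀ n, (1 / 4 : ℝ) ≤ tvDist (tree c) (Ψ n) ∅ (τ n) {v} := by
      intro n
      have h1 := le_tvDist_singleton (G := tree c) (Ψ := Ψ n) (σ := ∅) (τ := τ n) v
      have h2 := hhalf n
      rw [hfree, abs_of_nonneg (by linarith)] at h1
      linarith
    have := ge_of_tendsto' hlim hge
    norm_num at this
  · refine tendsto_of_tendsto_of_tendsto_of_le_of_le ENat.tendsto_natCast_nhds_top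
      tendsto_const_nhds (fun n => ?_) (fun n => le_top)
    refine le_iInf₂ fun u hu => le_iInf₂ fun w hw => le_edist ?_
    have hw : w = ψ (2 * n + 1) := by simpa [hτdef, symmDiff] using hw
    rw [Finset.mem_singleton.1 hu, hw, hlen]
    omega

end Strong

/-! ### Assembly of the threshold statements -/

section Main

open MeasureTheory ProbabilityTheory

variable {d : ℝ}

lemma measurableSet_infinite_vertex : MeasurableSet {c | Infinite (Vertex c)} := by
  simp only [infinite_vertex_iff]
  exact measurableSet_survive

/-- Below the threshold, infinite Poisson trees have weak but not strong spatial mixing. -/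
lemma ae_wsm_and_not_ssm (hd : 0 < d) (hdt : d < Real.exp (1 / √2) / √2) (hde : d < Real.exp 1) :
    ∀ᵐ c ∂(poissonTreeInf d), WSM (tree c) ∧ ¬ SSM (tree c) := by
  unfold poissonTreeInf ProbabilityTheory.cond
  refine Measure.ae_smul_measure ?_ _
  rw [ae_restrict_iff' measurableSet_infinite_vertex]
  filter_upwards [ae_exists_notMem_reach hd hdt hde, ae_exists_branching hd] with c h1 h2 hinf
  obtain ⟨l, hl, hb⟩ := h2 ((infinite_vertex_iff c).1 hinf)
  exact ⟨wsm_of_reach h1, fun h => not_ssmAt_of_twoChildren (v := ⟨l, hl⟩) hb (h _)⟩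

/-- A drawn position has a drawn child, so play can continue forever. -/
lemma draw_subset_survive : draw ⊆ survive := by
  have : ∀ n c, c ∈ draw → c ∈ heightGe n := by
    intro n
    induction n with
    | zero => exact fun c _ => trivial
    | succ n ih =>
      intro c hc
      have h1 : c ∉ lose := fun h => hc (.inl h)
      have h2 : c ∉ win := fun h => hc (.inr h)
      rw [lose_eq] at h1
      have h1 : ∃ i, i < c [] ∧ shift [i] c ∉ win := by simpa [allChildren] using h1
      obtain ⟨i, hi, hw⟩ := h1
      exact ⟨i, hi, ih _ fun h => h.elim (fun h => h2 ⟨i, hi, h⟩) hw⟩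
  exact fun c hc => Set.mem_iInter.2 fun n => this n c hc

lemma two_draws_subset : {c | c [] = 2 ∧ ∀ i < 2, shift [i] c ∈ draw} ⊆
    {c | Infinite (Vertex c)} ∩ {c | ¬ WSMAt (tree c) {root c}} := by
  rintro c ⟨h1, h2⟩
  refine ⟨(infinite_vertex_iff c).2 ?_, not_wsmAt_root h1 h2⟩
  rw [survive_eq]
  exact ⟨0, by rw [h1]; norm_num, draw_subset_survive (h2 0 (by norm_num))⟩

lemma measure_infinite_not_wsmAt_pos (hde : Real.exp 1 < d) :
    0 < poissonTree d ({c | Infinite (Vertex c)} ∩ {c | ¬ WSMAt (tree c) {root c}}) := by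
  have h := prob_two_draws_pos hde
  rw [measureReal_def, ENNReal.toReal_pos_iff] at h
  exact h.1.trans_le (measure_mono two_draws_subset)

lemma not_ae_wsm (hde : Real.exp 1 < d) :
    ¬ ∀ᵐ c ∂(poissonTreeInf d), WSM (tree c) ∧ ¬ SSM (tree c) := by
  intro h
  have hpos := measure_infinite_not_wsmAt_pos hde
  unfold poissonTreeInf ProbabilityTheory.cond at h
  rw [Measure.ae_ennreal_smul_measure_iff (ENNReal.inv_ne_zero.2 (measure_ne_top _ _)),
    ae_restrict_iff' measurableSet_infinite_vertex] at h
  refine hpos.ne' (measure_mono_null ?_ (ae_iff.1 h))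
  rintro c ⟨h1, h2⟩ h3
  exact h2 ((h3 h1).1 _)

lemma one_lt_threshold : 1 < Real.exp (1 / √2) / √2 := by
  have h2 : (√2) ^ 2 = 2 := Real.sq_sqrt (by norm_num)
  have h0 : 0 < √2 := by positivity
  rw [lt_div_iff₀ h0, one_mul]
  have h1 : 1 / √2 = √2 / 2 := by field_simp; exact h2.symm
  have := Real.add_one_le_exp (1 / √2)
  rw [h1] at this ⊢
  have : √2 < 2 := by nlinarith
  linarith

lemma threshold_le : Real.exp (1 / √2) / √2 ≤ Real.exp 1 := by
  have h1 : 1 ≤ √2 := by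
    rw [show (1 : ℝ) = √1 by simp]
    exact Real.sqrt_le_sqrt (by norm_num)
  refine (div_le_self (Real.exp_pos _).le h1).trans (Real.exp_le_exp.2 ?_)
  rw [div_le_one (by positivity)]
  exact h1

end Main

end HardCore

theorem theorem3 :
    (∃ dstar : ℝ,
      IsGreatest {D : ℝ | 1 < D ∧ ∀ d : ℝ, 1 < d → d < D →
        ∀ᵐ c ∂(HardCore.poissonTreeInf d),
          HardCore.WSM (HardCore.tree c) ∧ ¬ HardCore.SSM (HardCore.tree c)} dstar ∧
      Real.exp (1 / √2) / √2 ≤ dstar ∧ dstar ≤ Real.exp 1) ∧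
    ∀ d : ℝ, Real.exp 1 < d →
      0 < HardCore.poissonTree d
        {c | ¬ HardCore.WSMAt (HardCore.tree c) {HardCore.root c}} := by
  refine ⟨?_, fun d hd => (HardCore.measure_infinite_not_wsmAt_pos hd).trans_le
    (MeasureTheory.measure_mono Set.inter_subset_right)⟩
  set s := {D : ℝ | 1 < D ∧ ∀ d : ℝ, 1 < d → d < D →
    ∀ᵐ c ∂(HardCore.poissonTreeInf d),
      HardCore.WSM (HardCore.tree c) ∧ ¬ HardCore.SSM (HardCore.tree c)}
  have hmem : Real.exp (1 / √2) / √2 ∈ s :=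
    ⟨HardCore.one_lt_threshold, fun d h1 h2 => HardCore.ae_wsm_and_not_ssm (by linarith) h2
      (h2.trans_le HardCore.threshold_le)⟩
  have hub : ∀ D ∈ s, D ≤ Real.exp 1 := by
    rintro D ⟨-, hD⟩
    by_contra! hlt
    obtain ⟨d, h1, h2⟩ := exists_between hlt
    have h3 : (1 : ℝ) < Real.exp 1 := by simp
    exact HardCore.not_ae_wsm h1 (hD d (h3.trans h1) h2)
  have hbdd : BddAbove s := ⟨_, hub⟩
  have hle := le_csSup hbdd hmem
  -- The supremum is attained because membership of `D` only concerns `d` strictly below `D`.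
  refine ⟨sSup s, ⟨⟨HardCore.one_lt_threshold.trans_le hle, fun d h1 h2 => ?_⟩,
    fun D hD => le_csSup hbdd hD⟩, hle, csSup_le ⟨_, hmem⟩ hub⟩
  obtain ⟨D, hD, hdD⟩ := exists_lt_of_lt_csSup ⟨_, hmem⟩ h2
  exact hD.2 d h1 hdD
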